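/- Let $\Bbbk$ be an algebraically closed field of characteristic $0$, let $V$ be a finite-dimensional $\Bbbk$-vector space with dual $V^\vee$, put $S=\operatorname{Sym}(V)$, and let $K\subseteq\bigwedge^2V$ be a linear subspace. Write $K^\perp=\ker\bigl(\bigwedge^2V^\vee\twoheadrightarrow K^\vee\bigr)$. The Koszul module $W(V,K)$ is the middle homology of $$K\otimes S\xrightarrow{\ \delta_2\ }V\otimes S\xrightarrow{\ \delta_1\ }S,\qquad \delta_2(v_1\wedge v_2\otimes f)=v_2\otimes v_1f-v_1\otimes v_2f,\quad \delta_1(v\otimes f)=vf.$$ The resonance variety is $$\mathcal R(V,K)=\{a\in V^\vee:\ \exists\, b\in V^\vee \text{ with } a\wedge b\in K^\perp\setminus\{0\}\}\cup\{0\}\subseteq V^\vee,$$ with the Zariski topology, and the projectivized resonance scheme is $\mathbf R(V,K)=\operatorname{Proj}\bigl(S/\operatorname{Ann}W(V,K)\bigr)$. A linear subspace $U\subseteq V^\vee$ is called isotropic if $\bigwedge^2U\subseteq K^\perp$, and separable if $K^\perp\cap\langle U\rangle_E\subseteq\bigwedge^2U$, where $\langle U\rangle_E$ is the ideal generated by $U$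 in the exterior algebra $E=\bigwedge V^\vee$. When all irreducible components of $\mathcal R(V,K)$ are linear subspaces, the resonance (equivalently, by convention, $W(V,K)$ or $\mathbf R(V,K)$) is called isotropic, respectively separable, if every irreducible component of $\mathcal R(V,K)$ is isotropic, respectively separable. **Theorem 1.1.** Suppose all irreducible components of $\mathcal R(V,K)$ are linear subspaces of $V^\vee$. 1. If $W(V,K)$ is separable, then the scheme $\mathbf R(V,K)$ is reduced and its irreducible components are pairwise disjoint. 2. If $\mathbf R(V,K)$ is reduced and isotropic, then it is separable. -/

import Mathlib

open scoped TensorProduct DirectSum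

noncomputable section

namespace KoszulResonance

universe u v

variable (k : Type u) [Field k] (V : Type v) [AddCommGroup V] [Module k V]

/-! ### The symmetric algebra with its standard grading -/

/-- The degree `n` part `Sym^n V` of the symmetric algebra `S = Sym V`: the span of the products
of `n` elements of `V`. -/
def symDeg (n : ℕ) : Submodule k (SymmetricAlgebra k V) :=
  LinearMap.range (SymmetricAlgebra.ι k V) ^ n

theorem ι_mem_symDeg (x : V) : SymmetricAlgebra.ι k V x ∈ symDeg k V 1 := by
  simp [symDeg]

instance symDeg_gradedMonoid : SetLike.GradedMonoid (symDeg k V) where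
  one_mem := by simp [symDeg]
  mul_mem i j a b ha hb := by
    simp only [symDeg, pow_add] at *
    exact Submodule.mul_mem_mul ha hb

/-- The linear map `V → ⨁ n, Sym^n V` onto the degree one summand. -/
def gradedι : V →ₗ[k] ⨁ n, symDeg k V n :=
  DirectSum.lof k ℕ (fun n => symDeg k V n) 1 ∘ₗ
    (SymmetricAlgebra.ι k V).codRestrict _ (ι_mem_symDeg k V)

theorem gradedι_apply (x : V) : gradedι k V x =
    DirectSum.of (fun n => symDeg k V n) 1 ⟨SymmetricAlgebra.ι k V x, ι_mem_symDeg k V x⟩ := rfl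

instance symDeg_gradedAlgebra : GradedAlgebra (symDeg k V) :=
  GradedAlgebra.ofAlgHom _ (SymmetricAlgebra.lift (gradedι k V))
    (by
      apply SymmetricAlgebra.algHom_ext
      ext x
      simp [gradedι_apply])
    (fun i x => by
      obtain ⟨x, hx⟩ := x
      unfold symDeg at hx
      induction hx using Submodule.pow_induction_on_left' with
      | algebraMap r => rw [AlgHom.commutes, DirectSum.algebraMap_apply]; rfl
      | add x y i hx hy ihx ihy =>
        rw [map_add, ihx, ihy, ← map_add]
        rfl
      | mem_mul m hm i x hx ih =>
        obtain ⟨_, rfl⟩ := hm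
        rw [map_mul, ih, SymmetricAlgebra.lift_ι_apply, gradedι_apply, DirectSum.of_mul_of]
        exact DirectSum.of_eq_of_gradedMonoid_eq (Sigma.subtype_ext (add_comm _ _) rfl))

/-! ### The Koszul module -/

/-- The homology `ker g / im f` of a complex `A → B → C` of `R`-modules at `B`. -/
abbrev MiddleHomology {R A B C : Type*} [CommRing R] [AddCommGroup A] [Module R A]
    [AddCommGroup B] [Module R B] [AddCommGroup C] [Module R C] (f : A →ₗ[R] B) (g : B →ₗ[R] C) :
    Type _ :=
  LinearMap.ker g ⧸ (LinearMap.range f).submoduleOf (LinearMap.ker g)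

theorem mem_annihilator_middleHomology {R A B C : Type*} [CommRing R] [AddCommGroup A]
    [Module R A] [AddCommGroup B] [Module R B] [AddCommGroup C] [Module R C] (f : A →ₗ[R] B)
    (g : B →ₗ[R] C) (r : R) :
    r ∈ Module.annihilator R (MiddleHomology f g) ↔
      ∀ z ∈ LinearMap.ker g, r • z ∈ LinearMap.range f := by
  rw [Module.mem_annihilator]
  constructor
  · intro h z hz
    have := h (Submodule.Quotient.mk ⟨z, hz⟩)
    rw [← Submodule.Quotient.mk_smul, Submodule.Quotient.mk_eq_zero] at this
    exact this
  · intro h w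
    obtain ⟨⟨z, hz⟩, rfl⟩ := Submodule.Quotient.mk_surjective _ w
    rw [← Submodule.Quotient.mk_smul, Submodule.Quotient.mk_eq_zero]
    exact h z hz

/-- The alternating map `(v₁, v₂) ↦ v₂ ⊗ v₁ - v₁ ⊗ v₂` with values in `V ⊗ S`, written as
`S ⊗ V`. -/
def koszulAlt : V [⋀^Fin 2]→ₗ[k] (SymmetricAlgebra k V ⊗[k] V) where
  toFun w := SymmetricAlgebra.ι k V (w 0) ⊗ₜ[k] w 1 - SymmetricAlgebra.ι k V (w 1) ⊗ₜ[k] w 0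
  map_update_add' w i x y := by
    fin_cases i <;> simp [TensorProduct.add_tmul, TensorProduct.tmul_add] <;> abel
  map_update_smul' w i c x := by
    fin_cases i <;> simp [TensorProduct.smul_tmul', TensorProduct.tmul_smul, smul_sub]
  map_eq_zero_of_eq' w i j h hij := by
    fin_cases i <;> fin_cases j <;> simp_all

/-- The Koszul differential `δ₁ : V ⊗ S → S`, `v ⊗ f ↦ v f`. -/
def koszulD1 : (SymmetricAlgebra k V ⊗[k] V) →ₗ[SymmetricAlgebra k V] SymmetricAlgebra k V :=
  (SymmetricAlgebra.ι k V).liftBaseChange (SymmetricAlgebra k V)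

/-- The Koszul differential `δ₂ : ⋀² V ⊗ S → V ⊗ S`,
`(v₁ ∧ v₂) ⊗ f ↦ v₂ ⊗ v₁ f - v₁ ⊗ v₂ f`. -/
def koszulD2 : (SymmetricAlgebra k V ⊗[k] (⋀[k]^2 V)) →ₗ[SymmetricAlgebra k V]
    (SymmetricAlgebra k V ⊗[k] V) :=
  (exteriorPower.alternatingMapLinearEquiv (koszulAlt k V)).liftBaseChange (SymmetricAlgebra k V)

theorem koszulD1_tmul (f : SymmetricAlgebra k V) (x : V) :
    koszulD1 k V (f ⊗ₜ x) = f * SymmetricAlgebra.ι k V x := by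
  simp [koszulD1]

theorem koszulD2_tmul (f : SymmetricAlgebra k V) (x y : V) :
    koszulD2 k V (f ⊗ₜ exteriorPower.ιMulti k 2 ![x, y]) =
      (f * SymmetricAlgebra.ι k V x) ⊗ₜ y - (f * SymmetricAlgebra.ι k V y) ⊗ₜ x := by
  simp [koszulD2, koszulAlt, smul_sub, TensorProduct.smul_tmul']

theorem koszulD1_koszulD2 : koszulD1 k V ∘ₗ koszulD2 k V = 0 := by
  refine LinearMap.ext fun m => ?_
  have h : ∀ w : ⋀[k]^2 V, koszulD1 k V (koszulD2 k V (1 ⊗ₜ w)) = 0 := by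
    have : ((koszulD1 k V ∘ₗ koszulD2 k V).restrictScalars k) ∘ₗ
        (TensorProduct.mk k (SymmetricAlgebra k V) (⋀[k]^2 V) 1) = 0 := by
      apply exteriorPower.linearMap_ext
      ext w
      simp [koszulD1, koszulD2, koszulAlt, mul_comm]
    exact fun w => LinearMap.congr_fun this w
  induction m using TensorProduct.induction_on with
  | zero => simp
  | tmul s w =>
    have : s ⊗ₜ[k] w = s • ((1 : SymmetricAlgebra k V) ⊗ₜ[k] w) := by
      simp [TensorProduct.smul_tmul']
    rw [this, map_smul, LinearMap.comp_apply, h]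
    simp
  | add x y hx hy => rw [map_add, hx, hy]; simp

variable {k V}

/-- The restriction of `δ₂` to `K ⊗ S`. -/
def koszulD2Restrict (K : Submodule k (⋀[k]^2 V)) :
    (SymmetricAlgebra k V ⊗[k] K) →ₗ[SymmetricAlgebra k V] (SymmetricAlgebra k V ⊗[k] V) :=
  koszulD2 k V ∘ₗ K.subtype.baseChange (SymmetricAlgebra k V)

theorem range_koszulD2Restrict_le (K : Submodule k (⋀[k]^2 V)) :
    LinearMap.range (koszulD2Restrict K) ≤ LinearMap.ker (koszulD1 k V) := by
  rintro _ ⟨x, rfl⟩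
  exact LinearMap.congr_fun (koszulD1_koszulD2 k V) _

/-- The Koszul module `W(V, K)`, the middle homology of `K ⊗ S → V ⊗ S → S`. -/
abbrev KoszulModule (K : Submodule k (⋀[k]^2 V)) : Type (max u v) :=
  MiddleHomology (koszulD2Restrict K) (koszulD1 k V)

/-- The ideal `I(V, K) = Ann W(V, K)` of `S`. -/
def resIdeal (K : Submodule k (⋀[k]^2 V)) : Ideal (SymmetricAlgebra k V) :=
  Module.annihilator (SymmetricAlgebra k V) (KoszulModule K)

/-! ### The ideal `I(V, K)` is homogeneous -/

variable (k V) in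
/-- The projection of `S ⊗ V` onto `Sym^n V ⊗ V`. -/
def tensorProj (n : ℕ) : (SymmetricAlgebra k V ⊗[k] V) →ₗ[k] (SymmetricAlgebra k V ⊗[k] V) :=
  (GradedAlgebra.proj (symDeg k V) n).rTensor V

theorem tensorProj_smul (n j : ℕ) (f : SymmetricAlgebra k V) (m : SymmetricAlgebra k V ⊗[k] V) :
    tensorProj k V n (f • tensorProj k V j m) =
      if j ≤ n then GradedAlgebra.proj (symDeg k V) (n - j) f • tensorProj k V j m else 0 := by
  induction m using TensorProduct.induction_on with
  | zero => simp
  | tmul s x =>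
    simp only [tensorProj, LinearMap.rTensor_tmul, TensorProduct.smul_tmul', smul_eq_mul,
      GradedAlgebra.proj_apply]
    split_ifs with h
    · rw [DirectSum.coe_decompose_mul_of_right_mem_of_le _ (SetLike.coe_mem _) h]
    · rw [DirectSum.coe_decompose_mul_of_right_mem_of_not_le _ (SetLike.coe_mem _) h]
      simp
  | add x y hx hy =>
    simp only [map_add, smul_add, hx, hy]
    split_ifs <;> simp

theorem koszulD1_tensorProj (n : ℕ) (m : SymmetricAlgebra k V ⊗[k] V) :
    koszulD1 k V (tensorProj k V n m) =
      GradedAlgebra.proj (symDeg k V) (n + 1) (koszulD1 k V m) := by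
  induction m using TensorProduct.induction_on with
  | zero => simp
  | tmul s x =>
    simp only [tensorProj, LinearMap.rTensor_tmul, koszulD1_tmul, GradedAlgebra.proj_apply]
    rw [DirectSum.coe_decompose_mul_add_of_right_mem _ (ι_mem_symDeg k V x)]
  | add x y hx hy => simp only [map_add, hx, hy]

theorem exists_sum_tensorProj (m : SymmetricAlgebra k V ⊗[k] V) :
    ∃ N₀ : ℕ, ∀ N, N₀ ≤ N → ∑ i ∈ Finset.range N, tensorProj k V i m = m := by
  classical
  induction m using TensorProduct.induction_on with
  | zero => exact ⟨0, by simp⟩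
  | tmul s x =>
    refine ⟨((DirectSum.decompose (symDeg k V) s).support).sup id + 1, fun N hN => ?_⟩
    simp only [tensorProj, LinearMap.rTensor_tmul, GradedAlgebra.proj_apply]
    rw [← TensorProduct.sum_tmul]
    congr 1
    conv_rhs => rw [← DirectSum.sum_support_decompose (symDeg k V) s]
    symm
    apply Finset.sum_subset
    · intro i hi
      have : i ≤ ((DirectSum.decompose (symDeg k V) s).support).sup id :=
        Finset.le_sup (f := id) hi
      simp only [Finset.mem_range]
      omega
    · intro i _ hi
      simpa using hi
  | add x y hx hy =>
    obtain ⟨a, ha⟩ := hx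
    obtain ⟨b, hb⟩ := hy
    refine ⟨max a b, fun N hN => ?_⟩
    simp only [map_add, Finset.sum_add_distrib]
    rw [ha N (le_trans (le_max_left _ _) hN), hb N (le_trans (le_max_right _ _) hN)]

theorem tensorProj_koszulD2 (w : ⋀[k]^2 V) :
    tensorProj k V 1 (koszulD2 k V (1 ⊗ₜ w)) = koszulD2 k V (1 ⊗ₜ w) := by
  have h : ∀ x : V, GradedAlgebra.proj (symDeg k V) 1 (SymmetricAlgebra.ι k V x) =
      SymmetricAlgebra.ι k V x := fun x => by
    rw [GradedAlgebra.proj_apply]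
    exact DirectSum.decompose_of_mem_same _ (ι_mem_symDeg k V x)
  have : (tensorProj k V 1 ∘ₗ (koszulD2 k V).restrictScalars k) ∘ₗ
      (TensorProduct.mk k (SymmetricAlgebra k V) (⋀[k]^2 V) 1) =
      ((koszulD2 k V).restrictScalars k) ∘ₗ
      (TensorProduct.mk k (SymmetricAlgebra k V) (⋀[k]^2 V) 1) := by
    apply exteriorPower.linearMap_ext
    ext w
    simp [koszulD2, koszulAlt, tensorProj, h]
  exact LinearMap.congr_fun this w

theorem tensorProj_mem_range (K : Submodule k (⋀[k]^2 V)) (n : ℕ)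
    {m : SymmetricAlgebra k V ⊗[k] V} (hm : m ∈ LinearMap.range (koszulD2Restrict K)) :
    tensorProj k V n m ∈ LinearMap.range (koszulD2Restrict K) := by
  obtain ⟨x, rfl⟩ := hm
  induction x using TensorProduct.induction_on with
  | zero => simp
  | tmul s w =>
    have h : koszulD2Restrict K (s ⊗ₜ w) =
        s • tensorProj k V 1 (koszulD2 k V (1 ⊗ₜ (w : ⋀[k]^2 V))) := by
      rw [tensorProj_koszulD2, ← map_smul]
      simp [koszulD2Restrict, TensorProduct.smul_tmul']
    rw [h, tensorProj_smul, tensorProj_koszulD2]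
    split_ifs
    · exact Submodule.smul_mem _ _ ⟨1 ⊗ₜ w, by simp [koszulD2Restrict]⟩
    · exact Submodule.zero_mem _
  | add x y hx hy =>
    rw [map_add, map_add]
    exact Submodule.add_mem _ hx hy

theorem mem_resIdeal_iff (K : Submodule k (⋀[k]^2 V)) (f : SymmetricAlgebra k V) :
    f ∈ resIdeal K ↔ ∀ z ∈ LinearMap.ker (koszulD1 k V),
      f • z ∈ LinearMap.range (koszulD2Restrict K) :=
  mem_annihilator_middleHomology _ _ f

theorem resIdeal_isHomogeneous (K : Submodule k (⋀[k]^2 V)) :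
    (resIdeal K).IsHomogeneous (symDeg k V) := by
  intro i f hf
  rw [mem_resIdeal_iff] at hf ⊢
  intro z hz
  obtain ⟨N, hN⟩ := exists_sum_tensorProj z
  rw [← hN N le_rfl, Finset.smul_sum]
  refine Submodule.sum_mem _ fun l _ => ?_
  have hl : tensorProj k V l z ∈ LinearMap.ker (koszulD1 k V) := by
    rw [LinearMap.mem_ker] at hz ⊢
    rw [koszulD1_tensorProj, hz, map_zero]
  have := tensorProj_mem_range K (i + l) (hf _ hl)
  rw [tensorProj_smul] at this
  simpa using this

/-! ### The projectivized resonance scheme -/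

/-- The grading on `S / I(V, K)` inherited from `S`. -/
def resDeg (K : Submodule k (⋀[k]^2 V)) (n : ℕ) :
    Submodule k (SymmetricAlgebra k V ⧸ resIdeal K) :=
  (symDeg k V n).map (Ideal.Quotient.mkₐ k (resIdeal K)).toLinearMap

instance resDeg_gradedMonoid (K : Submodule k (⋀[k]^2 V)) : SetLike.GradedMonoid (resDeg K) where
  one_mem := ⟨1, SetLike.GradedOne.one_mem, by simp⟩
  mul_mem i j a b ha hb := by
    obtain ⟨a, ha, rfl⟩ := ha
    obtain ⟨b, hb, rfl⟩ := hb
    exact ⟨a * b, SetLike.GradedMul.mul_mem ha hb, by simp⟩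

/-- The quotient map on the pieces of degree `n`. -/
def resDegMk (K : Submodule k (⋀[k]^2 V)) (n : ℕ) : symDeg k V n →+ resDeg K n where
  toFun x := ⟨Ideal.Quotient.mk (resIdeal K) x, x, x.2, rfl⟩
  map_zero' := by ext; simp
  map_add' x y := by ext; simp

/-- The decomposition of a class in `S / I(V, K)`, computed on a representative. -/
def resDecompose (K : Submodule k (⋀[k]^2 V)) :
    (SymmetricAlgebra k V ⧸ resIdeal K) →+ ⨁ n, resDeg K n :=
  QuotientAddGroup.lift _
    ((DirectSum.map (resDegMk K)).comp
      (DirectSum.decomposeAddEquiv (symDeg k V)).toAddMonoidHom)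
    (fun f hf => by
      have hf' : f ∈ resIdeal K := by simpa using hf
      ext n
      have := resIdeal_isHomogeneous K n hf'
      simpa [resDegMk, Ideal.Quotient.eq_zero_iff_mem] using this)

theorem resDecompose_mk (K : Submodule k (⋀[k]^2 V)) (f : SymmetricAlgebra k V) :
    resDecompose K (Ideal.Quotient.mk (resIdeal K) f) =
      DirectSum.map (resDegMk K) (DirectSum.decompose (symDeg k V) f) := rfl

instance resDeg_gradedRing (K : Submodule k (⋀[k]^2 V)) : GradedRing (resDeg K) where
  toDecomposition := DirectSum.Decomposition.ofAddHom _ (resDecompose K)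
    (by
      ext q
      obtain ⟨f, rfl⟩ := Ideal.Quotient.mk_surjective q
      simp only [AddMonoidHom.comp_apply, resDecompose_mk, AddMonoidHom.id_apply]
      induction f using DirectSum.Decomposition.inductionOn (symDeg k V) with
      | zero => simp
      | homogeneous m => simp [resDegMk]
      | add a b ha hb => rw [DirectSum.decompose_add, map_add, map_add, ha, hb, map_add])
    (by
      ext n ⟨_, f, hf, rfl⟩ : 2
      simp only [AddMonoidHom.comp_apply, AddMonoidHom.id_apply,
        DirectSum.coeAddMonoidHom_of]
      change resDecompose K (Ideal.Quotient.mk (resIdeal K) f) = _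
      rw [resDecompose_mk, DirectSum.decompose_of_mem _ hf, DirectSum.map_of]
      rfl)

/-- The projectivized resonance scheme `𝐑(V, K) = Proj (S / Ann W(V, K))`. -/
def projResonance (K : Submodule k (⋀[k]^2 V)) : AlgebraicGeometry.Scheme.{max u v} :=
  AlgebraicGeometry.Proj (resDeg K)

/-! ### The resonance variety and its components -/

/-- `K^⊥ ⊆ ⋀² V^∨`, the kernel of the projection `⋀² V^∨ = (⋀² V)^∨ → K^∨`. -/
def perp (K : Submodule k (⋀[k]^2 V)) : Submodule k (⋀[k]^2 (Module.Dual k V)) :=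
  LinearMap.ker (K.dualRestrict ∘ₗ exteriorPower.pairingDual k V 2)

/-- The resonance variety `𝓡(V, K) ⊆ V^∨`:
`{a : there is b with a ∧ b ∈ K^⊥ \ {0}} ∪ {0}`. -/
def resonance (K : Submodule k (⋀[k]^2 V)) : Set (Module.Dual k V) :=
  {a | ∃ b : Module.Dual k V, exteriorPower.ιMulti k 2 ![a, b] ∈ perp K ∧
    exteriorPower.ιMulti k 2 ![a, b] ≠ 0} ∪ {0}

/-- The point of `Spec S` given by `a ∈ V^∨`: the kernel of evaluation `S → k` at `a`. -/
def evalPoint (a : Module.Dual k V) : PrimeSpectrum (SymmetricAlgebra k V) :=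
  ⟨RingHom.ker (SymmetricAlgebra.lift a : SymmetricAlgebra k V →ₐ[k] k),
    RingHom.ker_isPrime _⟩

variable (k V) in
/-- The Zariski topology on the affine space `V^∨`. -/
@[reducible]
def zariski : TopologicalSpace (Module.Dual k V) :=
  TopologicalSpace.induced evalPoint inferInstance

/-- The Zariski closed subsets of `V^∨` are the zero sets of families of polynomials. -/
theorem isClosed_zariski_iff (Z : Set (Module.Dual k V)) :
    @IsClosed _ (zariski k V) Z ↔ ∃ T : Set (SymmetricAlgebra k V),
      Z = {a | ∀ f ∈ T, SymmetricAlgebra.lift a f = 0} := by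
  rw [zariski, isClosed_induced_iff]
  constructor
  · rintro ⟨t, ht, rfl⟩
    obtain ⟨T, rfl⟩ := (PrimeSpectrum.isClosed_iff_zeroLocus t).1 ht
    exact ⟨T, rfl⟩
  · rintro ⟨T, rfl⟩
    exact ⟨PrimeSpectrum.zeroLocus T, PrimeSpectrum.isClosed_zeroLocus T, rfl⟩

/-- `Z` is an irreducible component of `𝓡(V, K)`: a maximal irreducible subset of it, for the
Zariski topology. -/
def IsResonanceComponent (K : Submodule k (⋀[k]^2 V)) (Z : Set (Module.Dual k V)) : Prop :=
  Maximal (fun Y => Y ⊆ resonance K ∧ @IsIrreducible _ (zariski k V) Y) Z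

/-- All the irreducible components of `𝓡(V, K)` are linear subspaces of `V^∨`. -/
def LinearResonance (K : Submodule k (⋀[k]^2 V)) : Prop :=
  ∀ Z, IsResonanceComponent K Z → ∃ U : Submodule k (Module.Dual k V), (U : Set _) = Z

/-! ### Isotropic and separable subspaces -/

/-- The subspace `⋀² U` of `⋀² V^∨`, for a linear subspace `U ⊆ V^∨`. -/
def wedgeSq (U : Submodule k (Module.Dual k V)) : Submodule k (⋀[k]^2 (Module.Dual k V)) :=
  LinearMap.range (exteriorPower.map (R := k) (M := U) (N := Module.Dual k V) 2 U.subtype)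

/-- `U` is isotropic with respect to `K`: `⋀² U ⊆ K^⊥`. -/
def IsIsotropic (K : Submodule k (⋀[k]^2 V)) (U : Submodule k (Module.Dual k V)) : Prop :=
  wedgeSq U ≤ perp K

/-- `U` is separable with respect to `K`: `K^⊥ ∩ ⟨U⟩_E ⊆ ⋀² U`, where `⟨U⟩_E` is the ideal of the
exterior algebra `E = ⋀ V^∨` generated by `U`. -/
def IsSeparableSubspace (K : Submodule k (⋀[k]^2 V)) (U : Submodule k (Module.Dual k V)) : Prop :=
  ∀ ω ∈ perp K,
    (ω : ExteriorAlgebra k (Module.Dual k V)) ∈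
      TwoSidedIdeal.span (ExteriorAlgebra.ι k '' (U : Set (Module.Dual k V))) →
    ω ∈ wedgeSq U

/-- The resonance of `(V, K)` is isotropic: it is linear and all its irreducible components
are isotropic. -/
def IsotropicResonance (K : Submodule k (⋀[k]^2 V)) : Prop :=
  LinearResonance K ∧
    ∀ U : Submodule k (Module.Dual k V), IsResonanceComponent K U → IsIsotropic K U

/-- The resonance of `(V, K)` is separable: it is linear and all its irreducible components
are separable. -/
def SeparableResonance (K : Submodule k (⋀[k]^2 V)) : Prop :=
  LinearResonance K ∧
    ∀ U : Submodule k (Module.Dual k V), IsResonanceComponent K U → IsSeparableSubspace K U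

end KoszulResonance

end

noncomputable section

namespace KoszulResonance

universe u v

variable {k : Type u} [Field k] {V : Type v} [AddCommGroup V] [Module k V]

/-! ### Bivectors and alternating forms -/

/-! Write P = U^⊥ ⊆ V, let L(U) ⊆ S be the prime ideal generated by P, and let I = Ann W(V, K).
Bivectors on V^∨ are read as alternating forms on V: those in ⟨U⟩_E vanish on P × P, those in ⋀²U
vanish on P × V. Dually, separability of U gives P ∧ V ⊆ K + ⋀²P
(`wedge_mem_sup_of_isSeparableSubspace`). Away from the origin the zeros of I are the resonance: a
partner b of a yields a functional detecting W at a, and the converse is Nakayama's lemma. By the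
Nullstellensatz, every prime over I contains L(U) for some component U.

Separable implies reduced with disjoint components. Let q ⊇ L(U) be a prime missing some u ∈ V.
Modulo the image of K ⊗ S, the classes of Koszul cycles satisfy u[x∧y] = x[u∧y] - y[u∧x]. By
separability the module N generated by [P∧V] is generated by [⋀²P], so uN ⊆ L(U)N, and
Cayley–Hamilton produces g ∉ q killing N (`exists_notMem_smul_eq_zero`). The same relation then
gives u g L(U) ⊆ I. Thus I and L(U) agree locally at each point of Proj: the stalk is reduced and
only one component passes through the point.

Reduced and isotropic implies separable. For a nonzero component U, reducedness at the generic point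
of ℙ(U) gives, for each p ∈ P, some g ∉ L(U) with gp ∈ I; hence L(U) kills W near a general a ∈ U.
Given ω ∈ K^⊥ ∩ ⟨U⟩_E, a functional on S ⊗ V built from ω and the differential at a kills the image
of K ⊗ S; evaluated on gp times a cycle, it forces ω(·, p) to be proportional to a
(`mul_form_eq_of_mul_mem_resIdeal`). So ω = a∧b modulo ⋀²U for one b. By isotropy a∧b ∈ K^⊥, and
maximality of U puts b in U. -/

variable (k) in
/-- The bivector `x ∧ y`, as a bilinear map. -/
def wedge : V →ₗ[k] V →ₗ[k] ⋀[k]^2 V :=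
  LinearMap.mk₂ k (fun x y => exteriorPower.ιMulti k 2 ![x, y])
    (fun x x' y => (exteriorPower.ιMulti k 2 (M := V)).map_vecCons_add ![y] x x')
    (fun c x y => (exteriorPower.ιMulti k 2 (M := V)).map_vecCons_smul ![y] c x)
    (fun x y y' => by
      have h : ∀ z, ![x, z] = Function.update ![x, y] 1 z := fun z => by
        ext i; fin_cases i <;> simp
      rw [h (y + y'), h y', (exteriorPower.ιMulti k 2 (M := V)).map_update_add ![x, y] 1 y y',
        ← h y])
    (fun c x y => by
      have h : ∀ z, ![x, z] = Function.update ![x, y] 1 z := fun z => by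
        ext i; fin_cases i <;> simp
      rw [h (c • y), (exteriorPower.ιMulti k 2 (M := V)).map_update_smul ![x, y] 1 c y,
        ← h y])

theorem wedge_apply (x y : V) : wedge k x y = exteriorPower.ιMulti k 2 ![x, y] := rfl

theorem wedge_self (x : V) : wedge k x x = 0 :=
  (exteriorPower.ιMulti k 2 (M := V)).map_eq_zero_of_eq ![x, x] (i := 0) (j := 1) rfl (by simp)

theorem wedge_swap (x y : V) : wedge k y x = - wedge k x y := by
  have h := wedge_self (k := k) (x + y)
  simp only [map_add, LinearMap.add_apply, wedge_self, zero_add, add_zero] at h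
  rw [eq_neg_iff_add_eq_zero]
  exact h

theorem bivector_hom_ext {N : Type*} [AddCommGroup N] [Module k N] {f g : ⋀[k]^2 V →ₗ[k] N}
    (h : ∀ x y, f (wedge k x y) = g (wedge k x y)) : f = g := by
  apply exteriorPower.linearMap_ext
  ext w
  have hw : w = ![w 0, w 1] := by ext i; fin_cases i <;> rfl
  rw [hw]
  exact h _ _

theorem span_wedge_eq_top :
    Submodule.span k {w : ⋀[k]^2 V | ∃ x y, w = wedge k x y} = ⊤ := by
  rw [eq_top_iff, ← exteriorPower.ιMulti_span k 2 V, Submodule.span_le]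
  rintro _ ⟨w, rfl⟩
  have hw : w = ![w 0, w 1] := by ext i; fin_cases i <;> rfl
  rw [hw]
  exact Submodule.subset_span ⟨_, _, rfl⟩

theorem bivector_induction {p : ⋀[k]^2 V → Prop} (hw : ∀ x y, p (wedge k x y))
    (h0 : p 0) (hadd : ∀ a b, p a → p b → p (a + b)) (hsmul : ∀ (c : k) a, p a → p (c • a))
    (w : ⋀[k]^2 V) : p w := by
  have : w ∈ Submodule.span k {w : ⋀[k]^2 V | ∃ x y, w = wedge k x y} := by
    rw [span_wedge_eq_top]; trivial
  induction this using Submodule.span_induction with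
  | mem x h => obtain ⟨a, b, rfl⟩ := h; exact hw a b
  | zero => exact h0
  | add x y _ _ hx hy => exact hadd x y hx hy
  | smul c x _ hx => exact hsmul c x hx

theorem map_wedge {V' : Type*} [AddCommGroup V'] [Module k V'] (f : V →ₗ[k] V') (x y : V) :
    exteriorPower.map 2 f (wedge k x y) = wedge k (f x) (f y) := by
  rw [wedge_apply, exteriorPower.map_apply_ιMulti, wedge_apply]
  congr 1
  ext i; fin_cases i <;> rfl

/-- The alternating form on `V` attached to an element of `⋀² V^∨`. -/
def form (ω : ⋀[k]^2 (Module.Dual k V)) : V →ₗ[k] V →ₗ[k] k :=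
  (wedge k).compr₂ (exteriorPower.pairingDual k V 2 ω)

theorem form_apply (ω : ⋀[k]^2 (Module.Dual k V)) (x y : V) :
    form ω x y = exteriorPower.pairingDual k V 2 ω (wedge k x y) := rfl

theorem form_swap (ω : ⋀[k]^2 (Module.Dual k V)) (x y : V) : form ω y x = - form ω x y := by
  rw [form_apply, form_apply, wedge_swap, map_neg]

theorem form_wedge (a b : Module.Dual k V) (x y : V) :
    form (wedge k a b) x y = a x * b y - b x * a y := by
  rw [form_apply, wedge_apply, wedge_apply, exteriorPower.pairingDual_ιMulti_ιMulti,
    Matrix.det_fin_two]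
  simp

theorem form_map_dualMap {V' : Type*} [AddCommGroup V'] [Module k V'] (f : V' →ₗ[k] V)
    (ω : ⋀[k]^2 (Module.Dual k V)) (x y : V') :
    form (exteriorPower.map 2 f.dualMap ω) x y = form ω (f x) (f y) := by
  induction ω using bivector_induction with
  | hw a b => rw [map_wedge, form_wedge, form_wedge]; rfl
  | h0 => simp [form_apply]
  | hadd a b ha hb => simp only [form_apply, map_add, LinearMap.add_apply] at *; rw [ha, hb]
  | hsmul c a ha => simp only [form_apply, map_smul, LinearMap.smul_apply] at *; rw [ha]

theorem mem_perp_iff (K : Submodule k (⋀[k]^2 V)) (ω : ⋀[k]^2 (Module.Dual k V)) :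
    ω ∈ perp K ↔ ∀ w ∈ K, exteriorPower.pairingDual k V 2 ω w = 0 := by
  rw [perp, LinearMap.mem_ker]
  constructor
  · intro h w hw
    exact LinearMap.congr_fun h ⟨w, hw⟩
  · intro h
    ext ⟨w, hw⟩
    exact h w hw

theorem wedge_eq_zero_imp {a t : Module.Dual k V} (ha : a ≠ 0) (h : wedge k a t = 0) :
    ∃ c : k, t = c • a := by
  obtain ⟨u, hu⟩ : ∃ u, a u ≠ 0 := by
    by_contra! hc
    exact ha (LinearMap.ext hc)
  refine ⟨(a u)⁻¹ * t u, LinearMap.ext fun x => ?_⟩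
  have := form_wedge a t u x
  rw [h] at this
  simp only [form_apply, map_zero, LinearMap.zero_apply] at this
  simp only [LinearMap.smul_apply, smul_eq_mul]
  field_simp
  linear_combination -this

/-- The sum runs over ordered pairs, so each basis bivector occurs twice; hence the factor 1/2. -/
theorem half_sum_form_smul_wedge [CharZero k] {ι : Type*} [Fintype ι]
    (e : Module.Basis ι k V) (ω : ⋀[k]^2 (Module.Dual k V)) :
    ∑ i, ∑ j, ((2 : k)⁻¹ * form ω (e i) (e j)) • wedge k (e.coord i) (e.coord j) = ω := by
  classical
  induction ω using bivector_induction with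
  | hw a b =>
    have hexp : ∀ c : Module.Dual k V, ∑ i, c (e i) • e.coord i = c := fun c => by
      refine e.ext fun j => ?_
      rw [LinearMap.sum_apply, Finset.sum_eq_single j] <;>
        simp +contextual [eq_comm]
    have h1 : ∀ a b : Module.Dual k V,
        ∑ i, ∑ j, (a (e i) * b (e j)) • wedge k (e.coord i) (e.coord j) = wedge k a b := by
      intro a b
      conv_rhs => rw [← hexp a, ← hexp b]
      simp only [map_sum, LinearMap.sum_apply, map_smul, LinearMap.smul_apply, Finset.smul_sum,
        smul_smul]
      rw [Finset.sum_comm]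
      simp only [mul_comm]
    have h2 : (2 : k)⁻¹ • (wedge k a b - wedge k b a) = wedge k a b := by
      rw [wedge_swap a b, sub_neg_eq_add, ← two_smul k, smul_smul, inv_mul_cancel₀ two_ne_zero,
        one_smul]
    conv_rhs => rw [← h2, ← h1 a b, ← h1 b a]
    simp only [← Finset.sum_sub_distrib, Finset.smul_sum, form_wedge, mul_smul, sub_smul]
  | h0 => simp [form_apply]
  | hadd a b ha hb =>
    simp only [form_apply, map_add, LinearMap.add_apply, mul_add, add_smul,
      Finset.sum_add_distrib] at *
    rw [ha, hb]
  | hsmul c a ha =>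
    conv_rhs => rw [← ha]
    simp only [form_apply, map_smul, LinearMap.smul_apply, Finset.smul_sum, smul_smul,
      smul_eq_mul]
    simp only [mul_left_comm c]

theorem eq_zero_of_form_eq_zero [CharZero k] [FiniteDimensional k V]
    {ω : ⋀[k]^2 (Module.Dual k V)} (h : ∀ x y, form ω x y = 0) : ω = 0 := by
  rw [← half_sum_form_smul_wedge (Module.finBasis k V) ω]
  simp [h]

theorem pairingDual_surjective [CharZero k] [FiniteDimensional k V] :
    Function.Surjective (exteriorPower.pairingDual k V 2) := by
  intro l
  let e := Module.finBasis k V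
  refine ⟨∑ i, ∑ j, ((2 : k)⁻¹ * l (wedge k (e i) (e j))) • wedge k (e.coord i) (e.coord j), ?_⟩
  apply bivector_hom_ext
  intro x y
  rw [← form_apply]
  have hl : ∀ x y : V, ∑ i, ∑ j, (e.coord i x * e.coord j y) * l (wedge k (e i) (e j)) =
      l (wedge k x y) := by
    intro x y
    conv_rhs => rw [← e.sum_repr x, ← e.sum_repr y]
    simp only [map_sum, LinearMap.sum_apply, map_smul, LinearMap.smul_apply, Finset.smul_sum,
      smul_smul, smul_eq_mul, Module.Basis.coord_apply]
    rw [Finset.sum_comm]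
    simp only [mul_comm]
  have h2 : l (wedge k x y) = (2 : k)⁻¹ * (l (wedge k x y) - l (wedge k y x)) := by
    rw [wedge_swap x y, map_neg, sub_neg_eq_add, ← two_mul, inv_mul_cancel_left₀ two_ne_zero]
  rw [h2, ← hl x y, ← hl y x]
  have hf : ∀ (i j), form (wedge k (e.coord i) (e.coord j)) x y =
      e.coord i x * e.coord j y - e.coord i y * e.coord j x := fun i j => by
    rw [form_wedge]; ring
  simp only [form_apply] at hf
  simp only [form_apply, map_sum, LinearMap.sum_apply, map_smul, LinearMap.smul_apply, hf,
    ← Finset.sum_sub_distrib, Finset.mul_sum, smul_eq_mul]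
  refine Finset.sum_congr rfl fun i _ => Finset.sum_congr rfl fun j _ => by ring

/-! ### Subspaces of the dual and their orthogonals -/

/-- A projection of `V` onto the orthogonal of `U`. -/
theorem exists_projection (U : Submodule k (Module.Dual k V)) :
    ∃ π : V →ₗ[k] V, (∀ x, π x ∈ U.dualCoannihilator) ∧ ∀ x ∈ U.dualCoannihilator, π x = x := by
  obtain ⟨g, hg⟩ := LinearMap.exists_leftInverse_of_injective U.dualCoannihilator.subtype
    (Submodule.ker_subtype _)
  exact ⟨U.dualCoannihilator.subtype ∘ₗ g, fun x => (g x).2,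
    fun x hx => congrArg Subtype.val (LinearMap.congr_fun hg ⟨x, hx⟩)⟩

theorem mem_of_forall_dualCoannihilator [FiniteDimensional k V]
    {U : Submodule k (Module.Dual k V)} {a : Module.Dual k V}
    (h : ∀ x ∈ U.dualCoannihilator, a x = 0) : a ∈ U := by
  rw [← Subspace.dualCoannihilator_dualAnnihilator_eq (W := U), Submodule.mem_dualAnnihilator]
  exact h

theorem wedge_mem_wedgeSq {U : Submodule k (Module.Dual k V)} {a b : Module.Dual k V}
    (ha : a ∈ U) (hb : b ∈ U) : wedge k a b ∈ wedgeSq U :=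
  ⟨wedge k ⟨a, ha⟩ ⟨b, hb⟩, map_wedge _ _ _⟩

theorem map_mem_wedgeSq {U : Submodule k (Module.Dual k V)}
    {f : Module.Dual k V →ₗ[k] Module.Dual k V} (hf : ∀ a, f a ∈ U)
    (ω : ⋀[k]^2 (Module.Dual k V)) : exteriorPower.map 2 f ω ∈ wedgeSq U := by
  induction ω using bivector_induction with
  | hw a b => rw [map_wedge]; exact wedge_mem_wedgeSq (hf a) (hf b)
  | h0 => rw [map_zero]; exact Submodule.zero_mem _
  | hadd a b ha hb => rw [map_add]; exact Submodule.add_mem _ ha hb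
  | hsmul c a ha => rw [map_smul]; exact Submodule.smul_mem _ c ha

/-- A form with U^⊥ in its radical is unchanged by pullback along `id - π`, whose transpose maps
into U. -/
theorem mem_wedgeSq_of_form [CharZero k] [FiniteDimensional k V]
    {U : Submodule k (Module.Dual k V)} {ω : ⋀[k]^2 (Module.Dual k V)}
    (h : ∀ x ∈ U.dualCoannihilator, ∀ y, form ω x y = 0) : ω ∈ wedgeSq U := by
  obtain ⟨π, h1, h2⟩ := exists_projection U
  have hρ : ∀ a : Module.Dual k V, (LinearMap.id - π).dualMap a ∈ U := fun a =>
    mem_of_forall_dualCoannihilator fun x hx => by simp [h2 x hx]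
  have key : exteriorPower.map 2 (LinearMap.id - π).dualMap ω = ω := by
    rw [← sub_eq_zero]
    apply eq_zero_of_form_eq_zero
    intro x y
    have : form (exteriorPower.map 2 (LinearMap.id - π).dualMap ω - ω) x y =
        form (exteriorPower.map 2 (LinearMap.id - π).dualMap ω) x y - form ω x y := by
      simp [form_apply]
    rw [this, form_map_dualMap]
    have e1 := h _ (h1 x) (y - π y)
    have e2 := h _ (h1 y) x
    rw [form_swap] at e2
    simp only [LinearMap.sub_apply, LinearMap.id_apply, map_sub] at *
    linear_combination -e1 + e2
  rw [← key]
  exact map_mem_wedgeSq hρ ω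

theorem form_eq_zero_of_mem_wedgeSq {U : Submodule k (Module.Dual k V)}
    {ω : ⋀[k]^2 (Module.Dual k V)} (h : ω ∈ wedgeSq U) {x : V} (hx : x ∈ U.dualCoannihilator)
    (y : V) : form ω x y = 0 := by
  obtain ⟨ω, rfl⟩ := h
  induction ω using bivector_induction with
  | hw a b =>
    rw [map_wedge, form_wedge]
    have h1 : U.subtype a x = 0 := (Submodule.mem_dualCoannihilator x).1 hx _ a.2
    have h2 : U.subtype b x = 0 := (Submodule.mem_dualCoannihilator x).1 hx _ b.2
    rw [h1, h2]; ring
  | h0 => simp [form_apply]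
  | hadd a b ha hb => simp only [form_apply, map_add, LinearMap.add_apply] at *; rw [ha, hb]; simp
  | hsmul c a ha => simp only [form_apply, map_smul, LinearMap.smul_apply] at *; rw [ha]; simp

theorem coe_map (f : V →ₗ[k] V) (w : ⋀[k]^2 V) :
    ((exteriorPower.map 2 f w : ⋀[k]^2 V) : ExteriorAlgebra k V) = ExteriorAlgebra.map f w := by
  induction w using bivector_induction with
  | hw a b =>
    rw [map_wedge]
    simp [wedge_apply, ExteriorAlgebra.ιMulti_apply]
  | h0 => simp
  | hadd a b ha hb => simp [ha, hb]
  | hsmul c a ha => simp [ha]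

/-- Pullback along `π` kills U, hence the ideal it generates, but preserves the values of a form on
U^⊥. -/
theorem form_eq_zero_of_mem_ideal {U : Submodule k (Module.Dual k V)}
    {ω : ⋀[k]^2 (Module.Dual k V)}
    (h : (ω : ExteriorAlgebra k (Module.Dual k V)) ∈
      TwoSidedIdeal.span (ExteriorAlgebra.ι k '' (U : Set (Module.Dual k V))))
    {x y : V} (hx : x ∈ U.dualCoannihilator) (hy : y ∈ U.dualCoannihilator) :
    form ω x y = 0 := by
  obtain ⟨π, h1, h2⟩ := exists_projection U
  have hker : TwoSidedIdeal.span (ExteriorAlgebra.ι k '' (U : Set (Module.Dual k V))) ≤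
      TwoSidedIdeal.ker (ExteriorAlgebra.map π.dualMap) := by
    rw [TwoSidedIdeal.span_le]
    rintro _ ⟨a, ha, rfl⟩
    rw [SetLike.mem_coe, TwoSidedIdeal.mem_ker, ExteriorAlgebra.map_apply_ι]
    have : π.dualMap a = 0 :=
      LinearMap.ext fun x => (Submodule.mem_dualCoannihilator _).1 (h1 x) a ha
    rw [this, map_zero]
  have h0 : exteriorPower.map 2 π.dualMap ω = 0 := by
    apply Subtype.ext
    rw [coe_map]
    simpa using (TwoSidedIdeal.mem_ker _).1 (hker h)
  have := form_map_dualMap π ω x y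
  rw [h0, h2 x hx, h2 y hy] at this
  rw [← this]
  simp [form_apply]

theorem mem_ideal_of_form [CharZero k] [FiniteDimensional k V]
    {U : Submodule k (Module.Dual k V)} {ω : ⋀[k]^2 (Module.Dual k V)}
    (h : ∀ x ∈ U.dualCoannihilator, ∀ y ∈ U.dualCoannihilator, form ω x y = 0) :
    (ω : ExteriorAlgebra k (Module.Dual k V)) ∈
      TwoSidedIdeal.span (ExteriorAlgebra.ι k '' (U : Set (Module.Dual k V))) := by
  set J := TwoSidedIdeal.span (ExteriorAlgebra.ι k '' (U : Set (Module.Dual k V))) with hJ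
  obtain ⟨π, h1, h2⟩ := exists_projection U
  have hρ : ∀ a : Module.Dual k V, a - π.dualMap a ∈ U := fun a =>
    mem_of_forall_dualCoannihilator fun x hx => by simp [h2 x hx]
  have h0 : exteriorPower.map 2 π.dualMap ω = 0 := by
    apply eq_zero_of_form_eq_zero
    intro x y
    rw [form_map_dualMap]
    exact h _ (h1 x) _ (h1 y)
  have key : ∀ ω : ⋀[k]^2 (Module.Dual k V),
      ((ω - exteriorPower.map 2 π.dualMap ω : ⋀[k]^2 (Module.Dual k V)) :
        ExteriorAlgebra k (Module.Dual k V)) ∈ J := by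
    intro ω
    induction ω using bivector_induction with
    | hw a b =>
      have : ∀ a b : Module.Dual k V, ((wedge k a b : ⋀[k]^2 (Module.Dual k V)) :
          ExteriorAlgebra k (Module.Dual k V)) = ExteriorAlgebra.ι k a * ExteriorAlgebra.ι k b := by
        intro a b
        simp [wedge_apply, ExteriorAlgebra.ιMulti_apply]
      rw [map_wedge, AddSubgroupClass.coe_sub, this, this]
      -- Telescoping: each summand has a factor `a - π.dualMap a` or `b - π.dualMap b` in U.
      have e : ExteriorAlgebra.ι k a * ExteriorAlgebra.ι k b -
          ExteriorAlgebra.ι k (π.dualMap a) * ExteriorAlgebra.ι k (π.dualMap b) =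
          ExteriorAlgebra.ι k (a - π.dualMap a) * ExteriorAlgebra.ι k b +
          ExteriorAlgebra.ι k (π.dualMap a) * ExteriorAlgebra.ι k (b - π.dualMap b) := by
        simp only [map_sub]; noncomm_ring
      rw [e]
      exact J.add_mem (J.mul_mem_right _ _ (TwoSidedIdeal.subset_span ⟨_, hρ a, rfl⟩))
        (J.mul_mem_left _ _ (TwoSidedIdeal.subset_span ⟨_, hρ b, rfl⟩))
    | h0 => simp
    | hadd a b ha hb =>
      rw [map_add, add_sub_add_comm]
      exact J.add_mem ha hb
    | hsmul c a ha =>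
      have e : c • a - exteriorPower.map 2 π.dualMap (c • a) =
          c • (a - exteriorPower.map 2 π.dualMap a) := by
        rw [map_smul]; module
      rw [e, Submodule.coe_smul, Algebra.smul_def]
      exact J.mul_mem_left _ _ ha
  simpa [h0] using key ω

/-- Separability of `U`, on the side of `V`: modulo `K`, every `p ∧ v` with `p ∈ U^⊥` lies in
`⋀² U^⊥`. -/
theorem wedge_mem_sup_of_isSeparableSubspace [CharZero k] [FiniteDimensional k V]
    {K : Submodule k (⋀[k]^2 V)} {U : Submodule k (Module.Dual k V)}
    (h : IsSeparableSubspace K U) {p : V} (hp : p ∈ U.dualCoannihilator) (v : V) :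
    wedge k p v ∈ K ⊔ Submodule.span k
      {w | ∃ q ∈ U.dualCoannihilator, ∃ r ∈ U.dualCoannihilator, w = wedge k q r} := by
  by_contra hn
  -- A separating functional is an alternating form: killing K puts it in K^⊥, killing ⋀²U^⊥ puts it
  -- in ⟨U⟩_E.
  obtain ⟨l, hl, hl0⟩ := Submodule.exists_le_ker_of_notMem hn
  obtain ⟨ω, rfl⟩ := pairingDual_surjective l
  have hω : ω ∈ wedgeSq U := by
    apply h
    · rw [mem_perp_iff]
      exact fun w hw => hl0 (Submodule.mem_sup_left hw)
    · apply mem_ideal_of_form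
      intro x hx y hy
      exact hl0 (Submodule.mem_sup_right (Submodule.subset_span ⟨x, hx, y, hy, rfl⟩))
  exact hl (form_eq_zero_of_mem_wedgeSq hω hp v)

/-! ### Polynomial functions on `V^∨` -/

instance symmetricAlgebra_finiteType [FiniteDimensional k V] :
    Algebra.FiniteType k (SymmetricAlgebra k V) :=
  Algebra.FiniteType.equiv inferInstance
    (SymmetricAlgebra.equivMvPolynomial (Module.finBasis k V)).symm

instance symmetricAlgebra_isNoetherianRing [FiniteDimensional k V] :
    IsNoetherianRing (SymmetricAlgebra k V) :=
  Algebra.FiniteType.isNoetherianRing k _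

/-- The ideal of the polynomials vanishing on `Y ⊆ V^∨`. -/
def zeroIdeal (Y : Set (Module.Dual k V)) : Ideal (SymmetricAlgebra k V) :=
  PrimeSpectrum.vanishingIdeal (evalPoint '' Y)

theorem mem_zeroIdeal {Y : Set (Module.Dual k V)} {f : SymmetricAlgebra k V} :
    f ∈ zeroIdeal Y ↔ ∀ a ∈ Y, SymmetricAlgebra.lift a f = 0 := by
  rw [zeroIdeal, PrimeSpectrum.mem_vanishingIdeal]
  simp only [Set.forall_mem_image]
  rfl

theorem isIrreducible_zariski_iff {Y : Set (Module.Dual k V)} :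
    @IsIrreducible _ (zariski k V) Y ↔ (zeroIdeal Y).IsPrime := by
  rw [zeroIdeal, ← PrimeSpectrum.isIrreducible_iff_vanishingIdeal_isPrime]
  let := zariski k V
  constructor
  · intro h
    exact h.image _ continuous_induced_dom.continuousOn
  · rintro ⟨h1, h2⟩
    refine ⟨Set.image_nonempty.1 h1, ?_⟩
    rintro _ _ ⟨u, hu, rfl⟩ ⟨w, hw, rfl⟩ ⟨x, hx, hxu⟩ ⟨y, hy, hyw⟩
    obtain ⟨_, ⟨z, hz, rfl⟩, hzu, hzw⟩ := h2 u w hu hw ⟨_, ⟨x, hx, rfl⟩, hxu⟩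
      ⟨_, ⟨y, hy, rfl⟩, hyw⟩
    exact ⟨z, hz, hzu, hzw⟩

/-- The common zeros in `V^∨` of an ideal of `S`. -/
def zeros (I : Ideal (SymmetricAlgebra k V)) : Set (Module.Dual k V) :=
  {a | ∀ f ∈ I, SymmetricAlgebra.lift a f = 0}

/-- Zariski's lemma: the residue field is finite over k, hence equal to k. -/
theorem exists_eq_ker_lift [IsAlgClosed k] [FiniteDimensional k V]
    (m : Ideal (SymmetricAlgebra k V)) [m.IsMaximal] :
    ∃ a : Module.Dual k V, m = RingHom.ker (SymmetricAlgebra.lift a : SymmetricAlgebra k V →ₐ[k] k)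
    := by
  let : Field (SymmetricAlgebra k V ⧸ m) := Ideal.Quotient.field m
  have hfin : Module.Finite k (SymmetricAlgebra k V ⧸ m) :=
    finite_of_finite_type_of_isJacobsonRing k (SymmetricAlgebra k V ⧸ m)
  have hbij := IsAlgClosed.algebraMap_bijective_of_isIntegral (k := k)
    (K := SymmetricAlgebra k V ⧸ m)
  let e : k ≃ₐ[k] (SymmetricAlgebra k V ⧸ m) := AlgEquiv.ofBijective (Algebra.ofId k _) hbij
  let φ : SymmetricAlgebra k V →ₐ[k] k := e.symm.toAlgHom.comp (Ideal.Quotient.mkₐ k m)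
  refine ⟨SymmetricAlgebra.lift.symm φ, ?_⟩
  rw [Equiv.apply_symm_apply]
  ext f
  rw [RingHom.mem_ker]
  change _ ↔ e.symm (Ideal.Quotient.mk m f) = 0
  rw [EmbeddingLike.map_eq_zero_iff, Ideal.Quotient.eq_zero_iff_mem]

/-- The Nullstellensatz: S is a Jacobson ring, so a prime is an intersection of maximal ideals, all
of them points. -/
theorem zeroIdeal_zeros [IsAlgClosed k] [FiniteDimensional k V]
    (q : Ideal (SymmetricAlgebra k V)) [hq : q.IsPrime] : zeroIdeal (zeros q) = q := by
  have : IsJacobsonRing (SymmetricAlgebra k V) := isJacobsonRing_of_finiteType (A := k)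
  apply le_antisymm
  · intro f hf
    have hj : q.jacobson = q := (isJacobsonRing_iff.1 this) q hq.isRadical
    rw [← hj, Ideal.jacobson, Ideal.mem_sInf]
    rintro m ⟨hqm, hm⟩
    obtain ⟨a, rfl⟩ := exists_eq_ker_lift m
    exact mem_zeroIdeal.1 hf a fun g hg => hqm hg
  · exact fun f hf => mem_zeroIdeal.2 fun a ha => ha f hf

theorem eq_zero_of_forall_lift_eq_zero [IsAlgClosed k] [FiniteDimensional k V]
    {f : SymmetricAlgebra k V} (h : ∀ a : Module.Dual k V, SymmetricAlgebra.lift a f = 0) :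
    f = 0 := by
  have : f ∈ zeroIdeal (zeros (⊥ : Ideal (SymmetricAlgebra k V))) :=
    mem_zeroIdeal.2 fun a _ => h a
  rwa [zeroIdeal_zeros] at this

/-- The ideal of `S` generated by the linear forms vanishing on `U`. -/
def linearIdeal (U : Submodule k (Module.Dual k V)) : Ideal (SymmetricAlgebra k V) :=
  Ideal.span (SymmetricAlgebra.ι k V '' U.dualCoannihilator)

theorem linearIdeal_le_iff {U : Submodule k (Module.Dual k V)}
    {I : Ideal (SymmetricAlgebra k V)} :
    linearIdeal U ≤ I ↔ ∀ p ∈ U.dualCoannihilator, SymmetricAlgebra.ι k V p ∈ I := by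
  rw [linearIdeal, Ideal.span_le]
  exact Set.image_subset_iff

theorem ι_mem_linearIdeal {U : Submodule k (Module.Dual k V)} {p : V}
    (hp : p ∈ U.dualCoannihilator) : SymmetricAlgebra.ι k V p ∈ linearIdeal U :=
  Ideal.subset_span ⟨p, hp, rfl⟩

/-- `σ` is composition of polynomial functions with a linear projection of V^∨ onto U. It identifies
`linearIdeal U` both with the polynomials vanishing on U and with a kernel into a domain. -/
theorem exists_retraction [FiniteDimensional k V] (U : Submodule k (Module.Dual k V)) :
    ∃ σ : SymmetricAlgebra k V →ₐ[k] SymmetricAlgebra k V,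
      (∀ f, f - σ f ∈ linearIdeal U) ∧
      ∀ a : Module.Dual k V, ∃ b ∈ U, ∀ f,
        SymmetricAlgebra.lift a (σ f) = SymmetricAlgebra.lift b f := by
  obtain ⟨π, h1, h2⟩ := exists_projection U
  let σ : SymmetricAlgebra k V →ₐ[k] SymmetricAlgebra k V :=
    SymmetricAlgebra.lift (SymmetricAlgebra.ι k V ∘ₗ (LinearMap.id - π))
  refine ⟨σ, fun f => ?_, fun a => ⟨a ∘ₗ (LinearMap.id - π), ?_, fun f => ?_⟩⟩
  · have : (Ideal.Quotient.mkₐ k (linearIdeal U)).comp σ = Ideal.Quotient.mkₐ k (linearIdeal U) := by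
      apply SymmetricAlgebra.algHom_ext
      ext x
      change Ideal.Quotient.mk _ (σ (SymmetricAlgebra.ι k V x)) =
        Ideal.Quotient.mk _ (SymmetricAlgebra.ι k V x)
      have hx : σ (SymmetricAlgebra.ι k V x) =
          SymmetricAlgebra.ι k V x - SymmetricAlgebra.ι k V (π x) := by simp [σ]
      rw [hx, map_sub, sub_eq_self]
      exact Ideal.Quotient.eq_zero_iff_mem.2 (ι_mem_linearIdeal (h1 x))
    rw [← Ideal.Quotient.eq_zero_iff_mem, map_sub, sub_eq_zero]
    exact (DFunLike.congr_fun this f).symm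
  · exact mem_of_forall_dualCoannihilator fun x hx => by simp [h2 x hx]
  · have : (SymmetricAlgebra.lift a : SymmetricAlgebra k V →ₐ[k] k).comp σ =
        SymmetricAlgebra.lift (a ∘ₗ (LinearMap.id - π)) := by
      apply SymmetricAlgebra.algHom_ext
      ext x
      simp [σ]
    exact DFunLike.congr_fun this f

theorem zeroIdeal_submodule [IsAlgClosed k] [FiniteDimensional k V]
    (U : Submodule k (Module.Dual k V)) : zeroIdeal (U : Set _) = linearIdeal U := by
  obtain ⟨σ, h1, h2⟩ := exists_retraction U
  apply le_antisymm
  · intro f hf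
    have : σ f = 0 := eq_zero_of_forall_lift_eq_zero fun a => by
      obtain ⟨b, hb, h⟩ := h2 a
      rw [h]
      exact mem_zeroIdeal.1 hf b hb
    simpa [this] using h1 f
  · rw [linearIdeal_le_iff]
    intro p hp
    rw [mem_zeroIdeal]
    intro a ha
    rw [SymmetricAlgebra.lift_ι_apply]
    exact (Submodule.mem_dualCoannihilator p).1 hp a ha

instance linearIdeal_isPrime [IsAlgClosed k] [FiniteDimensional k V]
    (U : Submodule k (Module.Dual k V)) : (linearIdeal U).IsPrime := by
  obtain ⟨σ, h1, h2⟩ := exists_retraction U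
  have : linearIdeal U = RingHom.ker σ := by
    apply le_antisymm
    · intro f hf
      rw [← zeroIdeal_submodule] at hf
      refine eq_zero_of_forall_lift_eq_zero fun a => ?_
      obtain ⟨b, hb, h⟩ := h2 a
      exact (h f).trans (mem_zeroIdeal.1 hf b hb)
    · intro f hf
      have h0 : σ f = 0 := hf
      simpa [h0] using h1 f
  rw [this]
  exact RingHom.ker_isPrime _

theorem mem_linearIdeal_iff [IsAlgClosed k] [FiniteDimensional k V]
    {U : Submodule k (Module.Dual k V)} {f : SymmetricAlgebra k V} :
    f ∈ linearIdeal U ↔ ∀ a ∈ U, SymmetricAlgebra.lift a f = 0 := by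
  rw [← zeroIdeal_submodule, mem_zeroIdeal]
  rfl

theorem isIrreducible_submodule [IsAlgClosed k] [FiniteDimensional k V]
    (U : Submodule k (Module.Dual k V)) :
    @IsIrreducible _ (zariski k V) (U : Set (Module.Dual k V)) := by
  rw [isIrreducible_zariski_iff, zeroIdeal_submodule]
  infer_instance

theorem exists_ι_notMem_linearIdeal {U : Submodule k (Module.Dual k V)} (hU : U ≠ ⊥)
    [IsAlgClosed k] [FiniteDimensional k V] :
    ∃ x : V, SymmetricAlgebra.ι k V x ∉ linearIdeal U := by
  by_contra! h
  apply hU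
  rw [eq_bot_iff]
  intro a ha
  refine LinearMap.ext fun x => ?_
  have := mem_linearIdeal_iff.1 (h x) a ha
  rwa [SymmetricAlgebra.lift_ι_apply] at this

/-! ### Koszul cycles and the ideal `I(V, K)` -/

variable (k V) in
/-- The restriction of `δ₂` to `⋀² V = ⋀² V ⊗ 1`. -/
def koszulCycle : ⋀[k]^2 V →ₗ[k] (SymmetricAlgebra k V ⊗[k] V) :=
  (koszulD2 k V).restrictScalars k ∘ₗ TensorProduct.mk k (SymmetricAlgebra k V) (⋀[k]^2 V) 1

theorem koszulCycle_wedge (x y : V) : koszulCycle k V (wedge k x y) =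
    SymmetricAlgebra.ι k V x ⊗ₜ y - SymmetricAlgebra.ι k V y ⊗ₜ x := by
  have := koszulD2_tmul k V (1 : SymmetricAlgebra k V) x y
  rw [one_mul, one_mul] at this
  exact this

theorem koszulCycle_mem_ker (w : ⋀[k]^2 V) : koszulCycle k V w ∈ LinearMap.ker (koszulD1 k V) :=
  LinearMap.mem_ker.2 (LinearMap.congr_fun (koszulD1_koszulD2 k V) (1 ⊗ₜ w))

theorem koszulD2Restrict_tmul (K : Submodule k (⋀[k]^2 V)) (s : SymmetricAlgebra k V) (w : K) :
    koszulD2Restrict K (s ⊗ₜ w) = s • koszulCycle k V w := by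
  change koszulD2 k V (s ⊗ₜ (w : ⋀[k]^2 V)) = s • koszulD2 k V (1 ⊗ₜ (w : ⋀[k]^2 V))
  rw [← map_smul, TensorProduct.smul_tmul', smul_eq_mul, mul_one]

theorem koszulCycle_mem_range {K : Submodule k (⋀[k]^2 V)} {w : ⋀[k]^2 V} (hw : w ∈ K) :
    koszulCycle k V w ∈ LinearMap.range (koszulD2Restrict K) :=
  ⟨1 ⊗ₜ ⟨w, hw⟩, by rw [koszulD2Restrict_tmul, one_smul]⟩

theorem eq_zero_of_mem_range_koszulD2Restrict {K : Submodule k (⋀[k]^2 V)}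
    {N : Type*} [AddCommGroup N] [Module k N]
    {Φ : (SymmetricAlgebra k V ⊗[k] V) →ₗ[k] N}
    (h : ∀ (s : SymmetricAlgebra k V), ∀ w ∈ K, Φ (s • koszulCycle k V w) = 0)
    {t : SymmetricAlgebra k V ⊗[k] V} (ht : t ∈ LinearMap.range (koszulD2Restrict K)) :
    Φ t = 0 := by
  obtain ⟨x, rfl⟩ := ht
  induction x using TensorProduct.induction_on with
  | zero => simp
  | tmul s w => rw [koszulD2Restrict_tmul]; exact h s w w.2
  | add x y hx hy => rw [map_add, map_add, hx, hy, add_zero]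

/-- This is δ₂δ₃(u∧x∧y) = 0 in the full Koszul complex, the only relation between cycles needed
later. -/
theorem ι_smul_koszulCycle_wedge (u x y : V) :
    SymmetricAlgebra.ι k V u • koszulCycle k V (wedge k x y) =
      SymmetricAlgebra.ι k V x • koszulCycle k V (wedge k u y) -
        SymmetricAlgebra.ι k V y • koszulCycle k V (wedge k u x) := by
  simp only [koszulCycle_wedge, smul_sub, TensorProduct.smul_tmul', smul_eq_mul]
  rw [mul_comm (SymmetricAlgebra.ι k V x) (SymmetricAlgebra.ι k V u),
    mul_comm (SymmetricAlgebra.ι k V y) (SymmetricAlgebra.ι k V u),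
    mul_comm (SymmetricAlgebra.ι k V x) (SymmetricAlgebra.ι k V y)]
  abel

/-- The contracting homotopy f ⊗ x ↦ f · (u∧x): multiplication by u is null-homotopic on the Koszul
complex. -/
theorem ι_smul_sub_mem_span (u : V) (z : SymmetricAlgebra k V ⊗[k] V) :
    SymmetricAlgebra.ι k V u • z - koszulD1 k V z • ((1 : SymmetricAlgebra k V) ⊗ₜ[k] u) ∈
      Submodule.span (SymmetricAlgebra k V) (Set.range (koszulCycle k V)) := by
  induction z using TensorProduct.induction_on with
  | zero => simp
  | tmul f x =>
    have : SymmetricAlgebra.ι k V u • (f ⊗ₜ[k] x) -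
        koszulD1 k V (f ⊗ₜ[k] x) • ((1 : SymmetricAlgebra k V) ⊗ₜ[k] u) =
        f • koszulCycle k V (wedge k u x) := by
      simp only [koszulCycle_wedge, koszulD1_tmul, smul_sub, TensorProduct.smul_tmul', smul_eq_mul,
        mul_one]
      rw [mul_comm (SymmetricAlgebra.ι k V u) f]
    rw [this]
    exact Submodule.smul_mem _ _ (Submodule.subset_span ⟨_, rfl⟩)
  | add x y hx hy =>
    rw [map_add, smul_add, add_smul, add_sub_add_comm]
    exact Submodule.add_mem _ hx hy

/-- Multiplication by u sends every cycle into the span of the δ₂(x∧y). Testing on those costs a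
factor u, harmless away from the origin. -/
theorem ι_mul_mem_resIdeal {K : Submodule k (⋀[k]^2 V)} {g : SymmetricAlgebra k V}
    (h : ∀ x y, g • koszulCycle k V (wedge k x y) ∈ LinearMap.range (koszulD2Restrict K)) (u : V) :
    SymmetricAlgebra.ι k V u * g ∈ resIdeal K := by
  have h' : ∀ w, g • koszulCycle k V w ∈ LinearMap.range (koszulD2Restrict K) := by
    intro w
    induction w using bivector_induction with
    | hw x y => exact h x y
    | h0 => simp
    | hadd a b ha hb => rw [map_add, smul_add]; exact Submodule.add_mem _ ha hb
    | hsmul c a ha => rw [map_smul, smul_comm]; exact Submodule.smul_of_tower_mem _ c ha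
  rw [mem_resIdeal_iff]
  intro z hz
  have h1 := ι_smul_sub_mem_span u z
  rw [LinearMap.mem_ker.1 hz, zero_smul, sub_zero] at h1
  rw [mul_comm, mul_smul]
  generalize SymmetricAlgebra.ι k V u • z = z' at h1
  induction h1 using Submodule.span_induction with
  | mem t ht => obtain ⟨w, rfl⟩ := ht; exact h' w
  | zero => simp
  | add s t _ _ hs ht => rw [smul_add]; exact Submodule.add_mem _ hs ht
  | smul r t _ ht => rw [smul_comm]; exact Submodule.smul_mem _ r ht

theorem smul_koszulCycle_mem {K : Submodule k (⋀[k]^2 V)} {f : SymmetricAlgebra k V}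
    (hf : f ∈ resIdeal K) (w : ⋀[k]^2 V) :
    f • koszulCycle k V w ∈ LinearMap.range (koszulD2Restrict K) :=
  (mem_resIdeal_iff K f).1 hf _ (koszulCycle_mem_ker w)

/-! ### The support of the Koszul module -/

/-- The functional `f ⊗ v ↦ f(a) b(v)` on `S ⊗ V`. -/
def evalTensor (a b : Module.Dual k V) : (SymmetricAlgebra k V ⊗[k] V) →ₗ[k] k :=
  LinearMap.mul' k k ∘ₗ TensorProduct.map
    (SymmetricAlgebra.lift a : SymmetricAlgebra k V →ₐ[k] k).toLinearMap b

theorem evalTensor_tmul (a b : Module.Dual k V) (f : SymmetricAlgebra k V) (x : V) :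
    evalTensor a b (f ⊗ₜ x) = SymmetricAlgebra.lift a f * b x := rfl

theorem evalTensor_smul_koszulCycle (a b : Module.Dual k V) (f : SymmetricAlgebra k V)
    (w : ⋀[k]^2 V) : evalTensor a b (f • koszulCycle k V w) =
      SymmetricAlgebra.lift a f * exteriorPower.pairingDual k V 2 (wedge k a b) w := by
  induction w using bivector_induction with
  | hw x y =>
    rw [← form_apply, form_wedge, koszulCycle_wedge, smul_sub, TensorProduct.smul_tmul',
      TensorProduct.smul_tmul', map_sub, evalTensor_tmul, evalTensor_tmul, smul_eq_mul,
      smul_eq_mul, map_mul, map_mul, SymmetricAlgebra.lift_ι_apply, SymmetricAlgebra.lift_ι_apply]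
    ring
  | h0 => simp
  | hadd p q hp hq => simp only [map_add, smul_add, hp, hq, mul_add]
  | hsmul c p hp =>
    rw [(koszulCycle k V).map_smul, smul_comm, (evalTensor a b).map_smul, hp, map_smul,
      smul_eq_mul, smul_eq_mul]
    ring

/-- With b a partner of a, `evalTensor a b` kills the image of K ⊗ S but sends f times some cycle to
a nonzero multiple of f(a). -/
theorem lift_eq_zero_of_mem_resIdeal [CharZero k] [FiniteDimensional k V]
    {K : Submodule k (⋀[k]^2 V)} {a : Module.Dual k V} (ha : a ∈ resonance K) (ha0 : a ≠ 0)
    {f : SymmetricAlgebra k V} (hf : f ∈ resIdeal K) : SymmetricAlgebra.lift a f = 0 := by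
  obtain ⟨b, hb, hb0⟩ | h := ha
  · rw [← wedge_apply, mem_perp_iff] at hb
    obtain ⟨x, y, hxy⟩ : ∃ x y, form (wedge k a b) x y ≠ 0 := by
      by_contra! hc
      exact hb0 (eq_zero_of_form_eq_zero hc)
    have := eq_zero_of_mem_range_koszulD2Restrict (Φ := evalTensor a b)
      (fun s w hw => by rw [evalTensor_smul_koszulCycle, hb w hw, mul_zero])
      (smul_koszulCycle_mem hf (wedge k x y))
    rw [evalTensor_smul_koszulCycle] at this
    exact (mul_eq_zero.1 this).resolve_right hxy
  · exact absurd h ha0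

section

variable {Q : Type*} [AddCommGroup Q] [Module (SymmetricAlgebra k V) Q] [Module k Q]
  [IsScalarTower k (SymmetricAlgebra k V) Q]

/-- Nakayama at a: a nonzero functional on the fibre N/mN would be a bivector a∧b in K^⊥, placing a
in the resonance. -/
theorem exists_smul_eq_zero_of_notMem_resonance [IsNoetherian (SymmetricAlgebra k V) Q]
    {K : Submodule k (⋀[k]^2 V)} {a : Module.Dual k V} (hn : a ∉ resonance K)
    {θ : ⋀[k]^2 V →ₗ[k] Q} (hθK : ∀ w ∈ K, θ w = 0)
    (hθ : ∀ u x y, SymmetricAlgebra.ι k V u • θ (wedge k x y) =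
      SymmetricAlgebra.ι k V x • θ (wedge k u y) - SymmetricAlgebra.ι k V y • θ (wedge k u x)) :
    ∃ r, SymmetricAlgebra.lift a r = 1 ∧ ∀ w, r • θ w = 0 := by
  have ha0 : a ≠ 0 := fun h => hn (Or.inr h)
  obtain ⟨u, hu⟩ : ∃ u, a u ≠ 0 := by
    by_contra! hc
    exact ha0 (LinearMap.ext hc)
  let m : Ideal (SymmetricAlgebra k V) :=
    RingHom.ker (SymmetricAlgebra.lift a : SymmetricAlgebra k V →ₐ[k] k)
  let N : Submodule (SymmetricAlgebra k V) Q :=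
    Submodule.span (SymmetricAlgebra k V) (Set.range θ)
  have hθN : ∀ w, θ w ∈ N := fun w => Submodule.subset_span ⟨w, rfl⟩
  have hle : N ≤ m • N := by
    rw [Submodule.span_le]
    rintro _ ⟨w, rfl⟩
    by_contra hw
    obtain ⟨l, hl, hl0⟩ := Submodule.exists_le_ker_of_notMem
      (p := (m • N).restrictScalars k) (v := θ w) hw
    have hlθ : ∀ (x : V) w, l (SymmetricAlgebra.ι k V x • θ w) = a x * l (θ w) := by
      intro x w
      have h1 : SymmetricAlgebra.ι k V x - algebraMap k _ (a x) ∈ m := by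
        rw [RingHom.mem_ker, map_sub]
        simp
      have h2 : l ((SymmetricAlgebra.ι k V x - algebraMap k _ (a x)) • θ w) = 0 := by
        have hmem := Submodule.smul_mem_smul h1 (hθN w)
        exact LinearMap.mem_ker.1 (hl0 ((Submodule.restrictScalars_mem k _ _).2 hmem))
      rw [sub_smul, map_sub, algebraMap_smul, l.map_smul, sub_eq_zero] at h2
      exact h2
    have hrel : ∀ x y, a u * l (θ (wedge k x y)) =
        a x * l (θ (wedge k u y)) - a y * l (θ (wedge k u x)) := by
      intro x y
      rw [← hlθ, ← hlθ, ← hlθ, ← map_sub, hθ]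
    -- Under `l` each x ∈ V acts as the scalar a(x), so the Koszul relation divided by a(u) reads l
    -- ∘ θ = a∧b.
    let b : Module.Dual k V := (a u)⁻¹ • (l ∘ₗ θ ∘ₗ wedge k u)
    have hb : exteriorPower.pairingDual k V 2 (wedge k a b) = l ∘ₗ θ := by
      apply bivector_hom_ext
      intro x y
      rw [← form_apply, form_wedge]
      simp only [b, LinearMap.smul_apply, LinearMap.comp_apply, smul_eq_mul]
      field_simp
      linear_combination -hrel x y
    apply hn
    refine Or.inl ⟨b, ?_, ?_⟩
    · rw [← wedge_apply, mem_perp_iff]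
      intro w hw
      rw [hb, LinearMap.comp_apply, hθK w hw, map_zero]
    · rw [← wedge_apply]
      intro h0
      rw [h0, map_zero] at hb
      exact hl (LinearMap.congr_fun hb.symm w)
  obtain ⟨r, hr, hrN⟩ := Submodule.exists_sub_one_mem_and_smul_eq_zero_of_fg_of_le_smul m N
    (IsNoetherian.noetherian N) hle
  refine ⟨r, ?_, fun w => hrN _ (hθN w)⟩
  have : SymmetricAlgebra.lift a (r - 1) = 0 := hr
  rwa [map_sub, map_one, sub_eq_zero] at this

/-- By `hθU`, N contains θ(p∧v) for all p ∈ U^⊥. The Koszul relation then gives uN ⊆ L(U)N, and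
Cayley–Hamilton applies to multiplication by u. -/
theorem exists_notMem_smul_eq_zero [IsNoetherian (SymmetricAlgebra k V) Q]
    {U : Submodule k (Module.Dual k V)} {θ : ⋀[k]^2 V →ₗ[k] Q}
    (hθU : ∀ p ∈ U.dualCoannihilator, ∀ v, ∃ w ∈ Submodule.span k
      {w | ∃ q ∈ U.dualCoannihilator, ∃ r ∈ U.dualCoannihilator, w = wedge k q r},
      θ (wedge k p v) = θ w)
    (hθ : ∀ u x y, SymmetricAlgebra.ι k V u • θ (wedge k x y) =
      SymmetricAlgebra.ι k V x • θ (wedge k u y) - SymmetricAlgebra.ι k V y • θ (wedge k u x))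
    {q : Ideal (SymmetricAlgebra k V)} [hqp : q.IsPrime]
    (hq : linearIdeal U ≤ q) {u : V} (hu : SymmetricAlgebra.ι k V u ∉ q) :
    ∃ g ∉ q, ∀ p ∈ U.dualCoannihilator, ∀ v, g • θ (wedge k p v) = 0 := by
  set D : Submodule k (⋀[k]^2 V) := Submodule.span k
      {w | ∃ q ∈ U.dualCoannihilator, ∃ r ∈ U.dualCoannihilator, w = wedge k q r} with hDdef
  let N : Submodule (SymmetricAlgebra k V) Q :=
    Submodule.span (SymmetricAlgebra k V) (D.map θ)
  have hDN : ∀ w ∈ D, θ w ∈ N := fun w hw => Submodule.subset_span ⟨w, hw, rfl⟩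
  have hPN : ∀ p ∈ U.dualCoannihilator, ∀ v, θ (wedge k p v) ∈ N := by
    intro p hp v
    obtain ⟨w, hw, h⟩ := hθU p hp v
    rw [h]
    exact hDN w hw
  have hD : ∀ w ∈ D, SymmetricAlgebra.ι k V u • θ w ∈ linearIdeal U • N := by
    intro w hw
    rw [hDdef] at hw
    induction hw using Submodule.span_induction with
    | mem w hw =>
      obtain ⟨x, hx, y, hy, rfl⟩ := hw
      rw [hθ, wedge_swap y, wedge_swap x, map_neg, map_neg]
      exact Submodule.sub_mem _
        (Submodule.smul_mem_smul (ι_mem_linearIdeal hx) (Submodule.neg_mem _ (hPN y hy u)))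
        (Submodule.smul_mem_smul (ι_mem_linearIdeal hy) (Submodule.neg_mem _ (hPN x hx u)))
    | zero => simp
    | add a b _ _ ha hb => rw [map_add, smul_add]; exact Submodule.add_mem _ ha hb
    | smul c a _ ha =>
      rw [map_smul, ← algebraMap_smul (SymmetricAlgebra k V) c (θ a), smul_comm]
      exact Submodule.smul_mem _ _ ha
  have hle : ∀ n ∈ N, SymmetricAlgebra.ι k V u • n ∈ linearIdeal U • N := by
    intro n hn
    induction hn using Submodule.span_induction with
    | mem n hn => obtain ⟨w, hw, rfl⟩ := hn; exact hD w hw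
    | zero => simp
    | add a b _ _ ha hb => rw [smul_add]; exact Submodule.add_mem _ ha hb
    | smul c a _ ha => rw [smul_comm]; exact Submodule.smul_mem _ c ha
  obtain ⟨p, hp, -, hcoeff, hp0⟩ :=
    LinearMap.exists_monic_and_natDegree_eq_and_coeff_mem_pow_and_aeval_eq_zero _
      (algebraMap (SymmetricAlgebra k V) (Module.End (SymmetricAlgebra k V) N)
        (SymmetricAlgebra.ι k V u)) (linearIdeal U) (by
        rintro _ ⟨n, rfl⟩
        rw [Submodule.mem_smul_top_iff]
        exact hle n n.2)
  rw [Polynomial.aeval_algebraMap_apply_eq_algebraMap_eval] at hp0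
  refine ⟨p.eval (SymmetricAlgebra.ι k V u), fun hgq => hu ?_, fun p hp v =>
    congrArg Subtype.val (LinearMap.congr_fun hp0 ⟨_, hPN p hp v⟩)⟩
  -- The non-leading coefficients lie in positive powers of L(U) ⊆ q, so p(u) is a power of u modulo
  -- q.
  rw [Polynomial.eval_eq_sum_range, Finset.sum_range_succ, hp.coeff_natDegree, one_mul] at hgq
  refine hqp.mem_of_pow_mem p.natDegree ((Ideal.add_mem_iff_right q ?_).1 hgq)
  refine Ideal.sum_mem _ fun i hi => Ideal.mul_mem_right _ _ (hq ?_)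
  have hi' : p.natDegree - i ≠ 0 := by
    rw [Finset.mem_range] at hi
    omega
  exact Ideal.pow_le_self hi' (hcoeff i)

end

/-- The class of a Koszul cycle modulo the image of `K ⊗ S`. -/
def cycleClass (K : Submodule k (⋀[k]^2 V)) :
    ⋀[k]^2 V →ₗ[k] ((SymmetricAlgebra k V ⊗[k] V) ⧸ LinearMap.range (koszulD2Restrict K)) :=
  (LinearMap.range (koszulD2Restrict K)).mkQ.restrictScalars k ∘ₗ koszulCycle k V

theorem smul_cycleClass_eq_zero_iff {K : Submodule k (⋀[k]^2 V)} {f : SymmetricAlgebra k V}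
    {w : ⋀[k]^2 V} : f • cycleClass K w = 0 ↔
      f • koszulCycle k V w ∈ LinearMap.range (koszulD2Restrict K) :=
  Submodule.Quotient.mk_eq_zero _

theorem cycleClass_eq_zero {K : Submodule k (⋀[k]^2 V)} {w : ⋀[k]^2 V} (hw : w ∈ K) :
    cycleClass K w = 0 :=
  (Submodule.Quotient.mk_eq_zero _).2 (koszulCycle_mem_range hw)

theorem ι_smul_cycleClass_wedge (K : Submodule k (⋀[k]^2 V)) (u x y : V) :
    SymmetricAlgebra.ι k V u • cycleClass K (wedge k x y) =
      SymmetricAlgebra.ι k V x • cycleClass K (wedge k u y) -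
        SymmetricAlgebra.ι k V y • cycleClass K (wedge k u x) :=
  congrArg (LinearMap.range (koszulD2Restrict K)).mkQ (ι_smul_koszulCycle_wedge u x y)

theorem mem_resonance_of_mem_zeros [FiniteDimensional k V] {K : Submodule k (⋀[k]^2 V)}
    {a : Module.Dual k V} (ha : a ∈ zeros (resIdeal K)) : a ∈ resonance K := by
  by_contra hn
  obtain ⟨r, h1, h2⟩ := exists_smul_eq_zero_of_notMem_resonance hn
    (θ := cycleClass K) (fun w hw => cycleClass_eq_zero hw) (ι_smul_cycleClass_wedge K)
  apply hn
  refine Or.inr (LinearMap.ext fun u => ?_)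
  -- Since u·r ∈ I and r(a) = 1, vanishing at a gives a(u) = 0 for every u.
  have := ha _ (ι_mul_mem_resIdeal (fun x y => smul_cycleClass_eq_zero_iff.1 (h2 (wedge k x y))) u)
  rwa [map_mul, h1, mul_one, SymmetricAlgebra.lift_ι_apply] at this

/-- Away from the origin, the Koszul module is annihilated by the ideal of any separable
subspace. -/
theorem exists_notMem_mul_mem_resIdeal [CharZero k] [FiniteDimensional k V]
    {K : Submodule k (⋀[k]^2 V)} {U : Submodule k (Module.Dual k V)}
    (hU : IsSeparableSubspace K U) {q : Ideal (SymmetricAlgebra k V)} [hqp : q.IsPrime]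
    (hq : linearIdeal U ≤ q) {u : V} (hu : SymmetricAlgebra.ι k V u ∉ q) :
    ∃ g ∉ q, ∀ f ∈ linearIdeal U, g * f ∈ resIdeal K := by
  obtain ⟨g, hg, hgN⟩ := exists_notMem_smul_eq_zero (θ := cycleClass K) (fun p hp v => by
    obtain ⟨w₁, h₁, w₂, h₂, h⟩ := Submodule.mem_sup.1
      (wedge_mem_sup_of_isSeparableSubspace hU hp v)
    exact ⟨w₂, h₂, by rw [← h, map_add, cycleClass_eq_zero h₁, zero_add]⟩)
    (ι_smul_cycleClass_wedge K) hq hu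
  refine ⟨SymmetricAlgebra.ι k V u * g, fun h => (hqp.mem_or_mem h).elim hu hg, ?_⟩
  have : linearIdeal U ≤ (resIdeal K).colon {SymmetricAlgebra.ι k V u * g} := by
    rw [linearIdeal_le_iff]
    intro p hp
    rw [Submodule.mem_colon_singleton, smul_eq_mul, mul_left_comm]
    apply ι_mul_mem_resIdeal
    intro x y
    rw [← smul_cycleClass_eq_zero_iff, mul_comm, mul_smul, ι_smul_cycleClass_wedge, smul_sub,
      smul_comm g, smul_comm g, hgN p hp y, hgN p hp x, smul_zero, smul_zero, sub_zero]
  intro f hf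
  have := Submodule.mem_colon_singleton.1 (this hf)
  rwa [smul_eq_mul, mul_comm] at this

/-! ### Components of the resonance -/

theorem exists_resonanceComponent {K : Submodule k (⋀[k]^2 V)} {Y : Set (Module.Dual k V)}
    (hY : @IsIrreducible _ (zariski k V) Y) (hYK : Y ⊆ resonance K) :
    ∃ Z, Y ⊆ Z ∧ IsResonanceComponent K Z := by
  let := zariski k V
  obtain ⟨Z, hYZ, hZ⟩ := zorn_subset_nonempty
    {Z : Set (Module.Dual k V) | Z ⊆ resonance K ∧ IsIrreducible Z} (by
      intro c hc hchain hne
      refine ⟨⋃₀ c, ⟨Set.sUnion_subset fun Z hZ => (hc hZ).1, ?_, ?_⟩,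
        fun Z hZ => Set.subset_sUnion_of_mem hZ⟩
      · obtain ⟨Z, hZ⟩ := hne
        obtain ⟨z, hz⟩ := (hc hZ).2.1
        exact ⟨z, Z, hZ, hz⟩
      · rintro u w hu hw ⟨x, ⟨Z, hZ, hxZ⟩, hxu⟩ ⟨y, ⟨Z', hZ', hyZ⟩, hyw⟩
        obtain h | h := hchain.total hZ hZ'
        · obtain ⟨t, ht, htu⟩ := (hc hZ').2.2 u w hu hw ⟨x, h hxZ, hxu⟩ ⟨y, hyZ, hyw⟩
          exact ⟨t, ⟨Z', hZ', ht⟩, htu⟩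
        · obtain ⟨t, ht, htu⟩ := (hc hZ).2.2 u w hu hw ⟨x, hxZ, hxu⟩ ⟨y, h hyZ, hyw⟩
          exact ⟨t, ⟨Z, hZ, ht⟩, htu⟩) Y ⟨hYK, hY⟩
  exact ⟨Z, hYZ, hZ⟩

theorem isIrreducible_zeros [IsAlgClosed k] [FiniteDimensional k V]
    (q : Ideal (SymmetricAlgebra k V)) [hq : q.IsPrime] :
    @IsIrreducible _ (zariski k V) (zeros q) := by
  rw [isIrreducible_zariski_iff, zeroIdeal_zeros]
  exact hq

/-- A prime ideal containing `I(V, K)` contains the ideal of a component of the resonance. -/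
theorem exists_component_linearIdeal_le [IsAlgClosed k] [FiniteDimensional k V]
    {K : Submodule k (⋀[k]^2 V)} (hlin : LinearResonance K)
    {q : Ideal (SymmetricAlgebra k V)} [hq : q.IsPrime] (hI : resIdeal K ≤ q) :
    ∃ U : Submodule k (Module.Dual k V), IsResonanceComponent K U ∧ linearIdeal U ≤ q := by
  obtain ⟨Z, hqZ, hZ⟩ := exists_resonanceComponent (isIrreducible_zeros q)
    (fun a ha => mem_resonance_of_mem_zeros fun f hf => ha f (hI hf))
  obtain ⟨U, rfl⟩ := hlin Z hZ
  refine ⟨U, hZ, ?_⟩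
  rw [← zeroIdeal_submodule, ← zeroIdeal_zeros q]
  exact fun f hf => mem_zeroIdeal.2 fun a ha => mem_zeroIdeal.1 hf a (hqZ ha)

/-- The origin is in the resonance by convention, but I need not vanish there; a linear form x
nonzero on U covers that point and is cancelled by primality. -/
theorem resIdeal_le_linearIdeal [IsAlgClosed k] [CharZero k] [FiniteDimensional k V]
    {K : Submodule k (⋀[k]^2 V)} {U : Submodule k (Module.Dual k V)} (hU : U ≠ ⊥)
    (hUK : (U : Set (Module.Dual k V)) ⊆ resonance K) : resIdeal K ≤ linearIdeal U := by
  obtain ⟨x, hx⟩ := exists_ι_notMem_linearIdeal hU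
  intro f hf
  refine ((linearIdeal_isPrime U).mem_or_mem (?_ : SymmetricAlgebra.ι k V x * f ∈ _)).resolve_left hx
  rw [mem_linearIdeal_iff]
  intro a ha
  rw [map_mul, SymmetricAlgebra.lift_ι_apply]
  by_cases h0 : a = 0
  · rw [h0, LinearMap.zero_apply, zero_mul]
  · rw [lift_eq_zero_of_mem_resIdeal (hUK ha) h0 hf, mul_zero]

/-- The zeros of a prime between I and L(U) form an irreducible subset of the resonance containing
U, so they equal U by maximality. -/
theorem linearIdeal_mem_minimalPrimes [IsAlgClosed k] [CharZero k] [FiniteDimensional k V]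
    {K : Submodule k (⋀[k]^2 V)} {U : Submodule k (Module.Dual k V)} (hU : U ≠ ⊥)
    (hUK : IsResonanceComponent K U) : linearIdeal U ∈ (resIdeal K).minimalPrimes := by
  refine ⟨⟨inferInstance, resIdeal_le_linearIdeal hU hUK.1.1⟩, ?_⟩
  rintro q ⟨hq, hI⟩ hle
  have h1 : (U : Set (Module.Dual k V)) ⊆ zeros q := fun a ha f hf =>
    mem_linearIdeal_iff.1 (hle hf) a ha
  have h2 : zeros q ⊆ (U : Set (Module.Dual k V)) := hUK.2
    ⟨fun a ha => mem_resonance_of_mem_zeros fun f hf => ha f (hI hf), isIrreducible_zeros q⟩ h1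
  rw [← zeroIdeal_submodule, Set.Subset.antisymm h1 h2, zeroIdeal_zeros]

/-- The partners `b` of a nonzero vector `a` of an isotropic component lie in the component. -/
theorem mem_of_wedge_mem_perp [IsAlgClosed k] [FiniteDimensional k V]
    {K : Submodule k (⋀[k]^2 V)} {U : Submodule k (Module.Dual k V)}
    (hUK : IsResonanceComponent K U) (hiso : IsIsotropic K U) {a b : Module.Dual k V}
    (ha : a ∈ U) (ha0 : a ≠ 0) (hab : wedge k a b ∈ perp K) : b ∈ U := by
  by_contra hb
  have hb0 : wedge k a b ≠ 0 := fun h => by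
    obtain ⟨c, rfl⟩ := wedge_eq_zero_imp ha0 h
    exact hb (U.smul_mem c ha)
  -- If b ∉ U, the larger space U + kb is still resonant, against maximality: a nonzero element has
  -- partner a, or partner b if it is proportional to a.
  have hT : ((U ⊔ k ∙ b : Submodule k (Module.Dual k V)) : Set (Module.Dual k V)) ⊆
      resonance K := by
    intro t ht
    obtain ⟨u, hu, s, hs, rfl⟩ := Submodule.mem_sup.1 ht
    obtain ⟨c, rfl⟩ := Submodule.mem_span_singleton.1 hs
    by_cases h0 : u + c • b = 0
    · exact Or.inr h0
    by_cases h1 : wedge k a (u + c • b) = 0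
    · obtain ⟨d, hd⟩ := wedge_eq_zero_imp ha0 h1
      refine Or.inl ⟨b, ?_⟩
      rw [← wedge_apply, hd, map_smul, LinearMap.smul_apply]
      refine ⟨Submodule.smul_mem _ _ hab, smul_ne_zero ?_ hb0⟩
      rintro rfl
      rw [zero_smul] at hd
      exact h0 hd
    · refine Or.inl ⟨a, ?_⟩
      rw [← wedge_apply, wedge_swap]
      refine ⟨Submodule.neg_mem _ ?_, neg_ne_zero.2 h1⟩
      rw [map_add, map_smul]
      exact Submodule.add_mem _ (hiso (wedge_mem_wedgeSq ha hu)) (Submodule.smul_mem _ _ hab)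
  have hle := hUK.2 ⟨hT, isIrreducible_submodule _⟩
    (le_sup_left : U ≤ U ⊔ k ∙ b)
  exact hb (hle (Submodule.mem_sup_right (Submodule.mem_span_singleton_self b)))

/-! ### The first order part at a point of an isotropic component -/

/-- The differential at the point `a` of polynomial functions on `V^∨`. -/
theorem exists_differential (a : Module.Dual k V) :
    ∃ d : SymmetricAlgebra k V →ₗ[k] V, (∀ x, d (SymmetricAlgebra.ι k V x) = x) ∧
      ∀ f g, d (f * g) = SymmetricAlgebra.lift a f • d g + SymmetricAlgebra.lift a g • d f := by
  let : Module kᵐᵒᵖ V := Module.compHom V ((RingHom.id k).fromOpposite mul_comm)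
  have : IsCentralScalar k V := ⟨fun _ _ => rfl⟩
  -- First-order Taylor expansion at a, x ↦ a(x) + εx; the differential is its ε-part.
  let φ : SymmetricAlgebra k V →ₐ[k] TrivSqZeroExt k V :=
    SymmetricAlgebra.lift ((TrivSqZeroExt.inlAlgHom k k V).toLinearMap ∘ₗ a +
      TrivSqZeroExt.inrHom k V)
  have hφ : ∀ x, φ (SymmetricAlgebra.ι k V x) = TrivSqZeroExt.inl (a x) + TrivSqZeroExt.inr x :=
    fun x => SymmetricAlgebra.lift_ι_apply _ x
  have hfst : ∀ f, (φ f).fst = SymmetricAlgebra.lift a f := by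
    have : (TrivSqZeroExt.fstHom k k V).comp φ = SymmetricAlgebra.lift a := by
      apply SymmetricAlgebra.algHom_ext
      ext x
      change (φ (SymmetricAlgebra.ι k V x)).fst = SymmetricAlgebra.lift a (SymmetricAlgebra.ι k V x)
      rw [hφ, SymmetricAlgebra.lift_ι_apply]
      simp
    exact fun f => DFunLike.congr_fun this f
  refine ⟨TrivSqZeroExt.sndHom k V ∘ₗ φ.toLinearMap, fun x => ?_, fun f g => ?_⟩
  · change (φ (SymmetricAlgebra.ι k V x)).snd = x
    rw [hφ]
    simp
  · change (φ (f * g)).snd = _ • (φ g).snd + _ • (φ f).snd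
    rw [map_mul, TrivSqZeroExt.snd_mul, hfst, hfst, op_smul_eq_smul]

/-- Says a ∧ ω(·, p) = 0. It comes from testing `hgp` against the functional f ⊗ x ↦ ω(x, π(df)),
with d the differential at a. -/
theorem mul_form_eq_of_mul_mem_resIdeal [FiniteDimensional k V] {K : Submodule k (⋀[k]^2 V)}
    {U : Submodule k (Module.Dual k V)} (hiso : IsIsotropic K U)
    {ω : ⋀[k]^2 (Module.Dual k V)} (hω : ω ∈ perp K)
    (hP : ∀ x ∈ U.dualCoannihilator, ∀ y ∈ U.dualCoannihilator, form ω x y = 0)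
    {a : Module.Dual k V} (ha : a ∈ U) {g : SymmetricAlgebra k V}
    (hg : SymmetricAlgebra.lift a g ≠ 0) {p : V} (hp : p ∈ U.dualCoannihilator)
    (hgp : g * SymmetricAlgebra.ι k V p ∈ resIdeal K) (u w : V) :
    a w * form ω u p = a u * form ω w p := by
  obtain ⟨d, hd1, hd2⟩ := exists_differential a
  obtain ⟨π, h1, h2⟩ := exists_projection U
  have hρ : ∀ c : Module.Dual k V, (LinearMap.id - π).dualMap c ∈ U := fun c =>
    mem_of_forall_dualCoannihilator fun x hx => by simp [h2 x hx]
  let ω' := exteriorPower.map 2 (LinearMap.id - π).dualMap ω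
  have hω' : ω' ∈ perp K := hiso (map_mem_wedgeSq hρ ω)
  let c : SymmetricAlgebra k V →ₗ[k] Module.Dual k V := (form ω).flip ∘ₗ π ∘ₗ d
  have hc : ∀ s x, c s x = form ω x (π (d s)) := fun _ _ => rfl
  have hcU : ∀ s, c s ∈ U := fun s =>
    mem_of_forall_dualCoannihilator fun x hx => hP x hx _ (h1 _)
  let Φ : (SymmetricAlgebra k V ⊗[k] V) →ₗ[k] k := TensorProduct.lift c
  -- All three bivectors on the right lie in K^⊥: ω by hypothesis, ω' and a∧c(s) by isotropy. Hence
  -- `Φ` kills the image of K ⊗ S.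
  have hΦ : ∀ s w, Φ (s • koszulCycle k V w) =
      SymmetricAlgebra.lift a s * (exteriorPower.pairingDual k V 2 ω' w -
        exteriorPower.pairingDual k V 2 ω w) +
      exteriorPower.pairingDual k V 2 (wedge k a (c s)) w := by
    intro s w
    induction w using bivector_induction with
    | hw x y =>
      rw [← form_apply, ← form_apply, ← form_apply, form_wedge, koszulCycle_wedge, smul_sub,
        TensorProduct.smul_tmul', TensorProduct.smul_tmul', map_sub, TensorProduct.lift.tmul,
        TensorProduct.lift.tmul, form_map_dualMap, hc, hc, hc, hc, smul_eq_mul, smul_eq_mul, hd2,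
        hd2, hd1, hd1, SymmetricAlgebra.lift_ι_apply, SymmetricAlgebra.lift_ι_apply]
      have e1 := hP _ (h1 x) _ (h1 y)
      have e2 := form_swap ω (π x) y
      simp only [map_add, map_sub, map_smul, LinearMap.sub_apply, LinearMap.id_apply,
        smul_eq_mul]
      rw [e1, e2]
      ring
    | h0 => simp
    | hadd p q hp hq => simp only [map_add, smul_add, hp, hq]; ring
    | hsmul c' p hp =>
      rw [(koszulCycle k V).map_smul, smul_comm, Φ.map_smul, hp, map_smul, map_smul, map_smul,
        smul_eq_mul, smul_eq_mul, smul_eq_mul, smul_eq_mul]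
      ring
  have hpair : ∀ {η : ⋀[k]^2 (Module.Dual k V)}, η ∈ perp K → ∀ w ∈ K,
      exteriorPower.pairingDual k V 2 η w = 0 := fun h => (mem_perp_iff K _).1 h
  have hzero := eq_zero_of_mem_range_koszulD2Restrict (Φ := Φ) (fun s w hw => by
    rw [hΦ, hpair hω' w hw, hpair hω w hw,
      hpair (hiso (wedge_mem_wedgeSq ha (hcU s))) w hw, sub_zero, mul_zero, zero_add])
    (smul_koszulCycle_mem hgp (wedge k u w))
  have hap : a p = 0 := (Submodule.mem_dualCoannihilator p).1 hp a ha
  -- As a(p) = 0, the differential of gp at a is g(a)p.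
  have hcs : ∀ x, c (g * SymmetricAlgebra.ι k V p) x = SymmetricAlgebra.lift a g * form ω x p := by
    intro x
    rw [hc, hd2, hd1, SymmetricAlgebra.lift_ι_apply, hap, zero_smul, add_zero, map_smul, map_smul,
      h2 p hp, smul_eq_mul]
  rw [hΦ, map_mul, SymmetricAlgebra.lift_ι_apply, hap, mul_zero, zero_mul, zero_add, ← form_apply,
    form_wedge, hcs, hcs] at hzero
  apply mul_left_cancel₀ hg
  linear_combination -hzero

theorem isSeparableSubspace_of_isIsotropic [IsAlgClosed k] [CharZero k] [FiniteDimensional k V]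
    {K : Submodule k (⋀[k]^2 V)} {U : Submodule k (Module.Dual k V)}
    (hUK : IsResonanceComponent K U) (hiso : IsIsotropic K U)
    {a : Module.Dual k V} (ha : a ∈ U) (ha0 : a ≠ 0)
    (h : ∀ p ∈ U.dualCoannihilator, ∃ g, SymmetricAlgebra.lift a g ≠ 0 ∧
      g * SymmetricAlgebra.ι k V p ∈ resIdeal K) : IsSeparableSubspace K U := by
  intro ω hω hωU
  have hP : ∀ x ∈ U.dualCoannihilator, ∀ y ∈ U.dualCoannihilator, form ω x y = 0 :=
    fun x hx y hy => form_eq_zero_of_mem_ideal hωU hx hy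
  obtain ⟨w, hw⟩ : ∃ w, a w ≠ 0 := by
    by_contra! hc
    exact ha0 (LinearMap.ext hc)
  -- Each ω(·, p) is a multiple of a, with factor ω(w, p)/a(w) = b(p); thus a∧b matches ω on U^⊥ ×
  -- V.
  let b : Module.Dual k V := (a w)⁻¹ • form ω w
  have hdiff : ω - wedge k a b ∈ wedgeSq U := by
    apply mem_wedgeSq_of_form
    intro p hp u
    obtain ⟨g, hg, hgp⟩ := h p hp
    have hrel := mul_form_eq_of_mul_mem_resIdeal hiso hω hP ha hg hp hgp u w
    have hap : a p = 0 := (Submodule.mem_dualCoannihilator p).1 hp a ha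
    have hs : form (ω - wedge k a b) p u = form ω p u - form (wedge k a b) p u := by
      simp [form_apply]
    rw [hs, form_wedge, form_swap ω u p, hap]
    simp only [b, LinearMap.smul_apply, smul_eq_mul]
    field_simp
    linear_combination -hrel
  have hab : wedge k a b ∈ perp K := by
    have := Submodule.sub_mem _ hω (hiso hdiff)
    rwa [sub_sub_cancel] at this
  have hb := mem_of_wedge_mem_perp hUK hiso ha ha0 hab
  have := Submodule.add_mem _ hdiff (wedge_mem_wedgeSq ha hb)
  rwa [sub_add_cancel] at this

/-- Covers the component {0}, which leaves no trace on Proj. -/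
theorem isSeparableSubspace_bot [CharZero k] [FiniteDimensional k V]
    (K : Submodule k (⋀[k]^2 V)) : IsSeparableSubspace K ⊥ := by
  intro ω _ hωU
  have : ω = 0 := eq_zero_of_form_eq_zero fun x y => form_eq_zero_of_mem_ideal hωU
    (by simp) (by simp)
  rw [this]
  exact Submodule.zero_mem _

/-! ### Localizations at prime ideals -/

/-- In the localization at a minimal prime q of I, the radical of I is the maximal ideal;
denominators are then cleared. -/
theorem exists_notMem_mul_pow_mem_of_mem_minimalPrimes {R : Type*} [CommRing R] {I q : Ideal R}
    (hq : q ∈ I.minimalPrimes) {x : R} (hx : x ∈ q) : ∃ y ∉ q, ∃ n : ℕ, y * x ^ n ∈ I := by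
  have hqp : q.IsPrime := hq.1.1
  have hmem : algebraMap R (Localization.AtPrime q) x ∈
      (I.map (algebraMap R (Localization.AtPrime q))).radical := by
    rw [IsLocalization.AtPrime.radical_map_of_mem_minimalPrimes (Localization.AtPrime q) q I hq]
    exact Ideal.mem_map_of_mem _ hx
  obtain ⟨n, hn⟩ := hmem
  rw [IsLocalization.mem_map_algebraMap_iff q.primeCompl] at hn
  obtain ⟨⟨a, b⟩, hn⟩ := hn
  rw [← map_pow, ← map_mul, IsLocalization.eq_iff_exists q.primeCompl] at hn
  obtain ⟨t, ht⟩ := hn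
  refine ⟨t * b, (t * b).2, n, ?_⟩
  have : (t : R) * b * x ^ n = t * (x ^ n * b) := by ring
  rw [this, ht]
  exact I.mul_mem_left _ a.2

theorem isReduced_localization_atPrime {R : Type*} [CommRing R] (q : Ideal R) [q.IsPrime]
    (h : ∀ f : R, IsNilpotent f → ∃ g ∉ q, g * f = 0) : IsReduced (Localization.AtPrime q) := by
  refine ⟨fun r ⟨n, hn⟩ => ?_⟩
  obtain ⟨f, s, rfl⟩ := IsLocalization.exists_mk'_eq q.primeCompl r
  rw [← IsLocalization.mk'_pow, IsLocalization.mk'_eq_zero_iff] at hn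
  obtain ⟨t, ht⟩ := hn
  obtain ⟨g, hg, hgf⟩ := h (t * f) ⟨n + 1, by
    have : ((t : R) * f) ^ (n + 1) = t ^ n * f * (t * f ^ n) := by ring
    rw [this, ht, mul_zero]⟩
  rw [IsLocalization.mk'_eq_zero_iff]
  exact ⟨⟨g, hg⟩ * t, by rw [Submonoid.coe_mul, mul_assoc]; exact hgf⟩

open AlgebraicGeometry

variable {K : Submodule k (⋀[k]^2 V)}

/-! ### Points of the projectivized resonance scheme -/

theorem mk_ι_mem_resDeg (K : Submodule k (⋀[k]^2 V)) (x : V) :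
    Ideal.Quotient.mk (resIdeal K) (SymmetricAlgebra.ι k V x) ∈ resDeg K 1 :=
  ⟨_, ι_mem_symDeg k V x, rfl⟩

/-- The prime ideal of `S` of a point of `Proj (S / I(V, K))`. -/
def pointIdeal (x : ProjectiveSpectrum (resDeg K)) : Ideal (SymmetricAlgebra k V) :=
  x.asHomogeneousIdeal.toIdeal.comap (Ideal.Quotient.mk (resIdeal K))

instance pointIdeal_isPrime (x : ProjectiveSpectrum (resDeg K)) : (pointIdeal x).IsPrime :=
  Ideal.comap_isPrime _ _

theorem resIdeal_le_pointIdeal (x : ProjectiveSpectrum (resDeg K)) :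
    resIdeal K ≤ pointIdeal x := by
  intro f hf
  rw [pointIdeal, Ideal.mem_comap, Ideal.Quotient.eq_zero_iff_mem.2 hf]
  exact Ideal.zero_mem _

theorem pointIdeal_le_iff {x y : ProjectiveSpectrum (resDeg K)} :
    pointIdeal x ≤ pointIdeal y ↔ x ≤ y := by
  rw [pointIdeal, pointIdeal,
    Ideal.comap_le_comap_iff_of_surjective _ Ideal.Quotient.mk_surjective]
  rfl

theorem symDeg_le_of_ι_mem {I : Ideal (SymmetricAlgebra k V)}
    (h : ∀ x, SymmetricAlgebra.ι k V x ∈ I) (n : ℕ) {f : SymmetricAlgebra k V}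
    (hf : f ∈ symDeg k V (n + 1)) : f ∈ I := by
  have : symDeg k V (n + 1) ≤ I.restrictScalars k := by
    rw [symDeg, pow_succ, Submodule.mul_le]
    rintro a - _ ⟨x, rfl⟩
    exact I.mul_mem_left _ (h x)
  exact this hf

theorem exists_ι_notMem_pointIdeal (x : ProjectiveSpectrum (resDeg K)) :
    ∃ u : V, SymmetricAlgebra.ι k V u ∉ pointIdeal x := by
  by_contra! h
  apply x.not_irrelevant_le
  change (HomogeneousIdeal.irrelevant (resDeg K)).toIdeal ≤ x.asHomogeneousIdeal.toIdeal
  rw [HomogeneousIdeal.irrelevant_eq_span, Ideal.span_le]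
  intro a ha
  simp only [Set.mem_iUnion] at ha
  obtain ⟨i, hi, f, hf, rfl⟩ := ha
  obtain ⟨n, rfl⟩ : ∃ n, i = n + 1 := ⟨i - 1, by omega⟩
  exact symDeg_le_of_ι_mem h n hf

/-- The generic point of the projectivization of a component `U` of the resonance. -/
theorem exists_pointIdeal_eq_linearIdeal [IsAlgClosed k] [FiniteDimensional k V]
    {U : Submodule k (Module.Dual k V)} (hU : U ≠ ⊥) (hI : resIdeal K ≤ linearIdeal U) :
    ∃ x : ProjectiveSpectrum (resDeg K), pointIdeal x = linearIdeal U := by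
  have hcomap : ((linearIdeal U).map (Ideal.Quotient.mk (resIdeal K))).comap
      (Ideal.Quotient.mk (resIdeal K)) = linearIdeal U := by
    rw [Ideal.comap_map_of_surjective _ Ideal.Quotient.mk_surjective, ← RingHom.ker_eq_comap_bot,
      Ideal.mk_ker, sup_eq_left.2 hI]
  have hhom : ((linearIdeal U).map (Ideal.Quotient.mk (resIdeal K))).IsHomogeneous (resDeg K) := by
    rw [linearIdeal, Ideal.map_span]
    apply Ideal.homogeneous_span
    rintro _ ⟨_, ⟨p, hp, rfl⟩, rfl⟩
    exact ⟨1, mk_ι_mem_resDeg K p⟩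
  have hprime : ((linearIdeal U).map (Ideal.Quotient.mk (resIdeal K))).IsPrime :=
    Ideal.map_isPrime_of_surjective Ideal.Quotient.mk_surjective (by rwa [Ideal.mk_ker])
  refine ⟨⟨⟨_, hhom⟩, hprime, fun hle => ?_⟩, hcomap⟩
  obtain ⟨x, hx⟩ := exists_ι_notMem_linearIdeal hU
  apply hx
  rw [← hcomap]
  exact hle (HomogeneousIdeal.mem_irrelevant_of_mem _ one_pos (mk_ι_mem_resDeg K x))

/-! ### Reducedness and components of the projectivized resonance scheme -/

/-- Near each point of Proj, I and L(U) coincide after inverting g; reducedness and disjointness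
both follow from this. -/
theorem SeparableResonance.exists_pointIdeal [IsAlgClosed k] [CharZero k] [FiniteDimensional k V]
    (hsep : SeparableResonance K) (x : ProjectiveSpectrum (resDeg K)) :
    ∃ U : Submodule k (Module.Dual k V), U ≠ ⊥ ∧ resIdeal K ≤ linearIdeal U ∧
      linearIdeal U ≤ pointIdeal x ∧
      ∃ g ∉ pointIdeal x, ∀ f ∈ linearIdeal U, g * f ∈ resIdeal K := by
  obtain ⟨U, hU, hle⟩ := exists_component_linearIdeal_le hsep.1 (resIdeal_le_pointIdeal x)
  obtain ⟨u, hu⟩ := exists_ι_notMem_pointIdeal x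
  have hU0 : U ≠ ⊥ := by
    rintro rfl
    exact hu (hle (ι_mem_linearIdeal (by simp)))
  exact ⟨U, hU0, resIdeal_le_linearIdeal hU0 hU.1.1, hle,
    exists_notMem_mul_mem_resIdeal (hsep.2 U hU) hle hu⟩

theorem SeparableResonance.isReduced_projResonance [IsAlgClosed k] [CharZero k]
    [FiniteDimensional k V] (hsep : SeparableResonance K) :
    AlgebraicGeometry.IsReduced (projResonance K) := by
  have : ∀ x : Proj (resDeg K), _root_.IsReduced ((Proj (resDeg K)).presheaf.stalk x) := by
    intro (x : ProjectiveSpectrum (resDeg K))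
    have h1 : _root_.IsReduced (Localization.AtPrime x.asHomogeneousIdeal.toIdeal) := by
      apply isReduced_localization_atPrime
      intro f hf
      obtain ⟨f, rfl⟩ := Ideal.Quotient.mk_surjective f
      obtain ⟨U, -, hI, -, g, hg, hgU⟩ := hsep.exists_pointIdeal x
      obtain ⟨n, hn⟩ := hf
      rw [← map_pow, Ideal.Quotient.eq_zero_iff_mem] at hn
      refine ⟨Ideal.Quotient.mk _ g, hg, ?_⟩
      rw [← map_mul, Ideal.Quotient.eq_zero_iff_mem]
      exact hgU f (Ideal.IsPrime.mem_of_pow_mem inferInstance n (hI hn))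
    have h2 : _root_.IsReduced
        (HomogeneousLocalization.AtPrime (resDeg K) x.asHomogeneousIdeal.toIdeal) :=
      isReduced_of_injective (algebraMap _ (Localization.AtPrime x.asHomogeneousIdeal.toIdeal))
        (HomogeneousLocalization.val_injective _)
    exact isReduced_of_injective (Proj.stalkIso (resDeg K) x).commRingCatIsoToRingEquiv
      (RingEquiv.injective _)
  exact isReduced_of_isReduced_stalk (Proj (resDeg K))

theorem SeparableResonance.pairwiseDisjoint_irreducibleComponents [IsAlgClosed k] [CharZero k]
    [FiniteDimensional k V] (hsep : SeparableResonance K) :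
    (irreducibleComponents (projResonance K)).PairwiseDisjoint id := by
  have hqs : QuasiSober (ProjectiveSpectrum (resDeg K)) :=
    inferInstanceAs (QuasiSober (Proj (resDeg K)))
  change (irreducibleComponents (ProjectiveSpectrum (resDeg K))).PairwiseDisjoint id
  intro Z₁ h₁ Z₂ h₂ hne
  by_contra hnd
  obtain ⟨x, hx₁, hx₂⟩ := Set.not_disjoint_iff.1 hnd
  obtain ⟨U, hU0, hI, hle, g, hg, hgU⟩ := hsep.exists_pointIdeal x
  obtain ⟨y, hy⟩ := exists_pointIdeal_eq_linearIdeal (K := K) hU0 hI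
  have key : ∀ Z ∈ irreducibleComponents (ProjectiveSpectrum (resDeg K)), x ∈ Z →
      Z = closure {y} := by
    intro Z hZ hxZ
    obtain ⟨z, hz⟩ := QuasiSober.sober hZ.1 (isClosed_of_mem_irreducibleComponents Z hZ)
    have hzx : z ≤ x := by
      rw [ProjectiveSpectrum.le_iff_mem_closure, hz.def]
      exact hxZ
    have hyz : y ≤ z := by
      rw [← pointIdeal_le_iff, hy]
      intro f hf
      -- g avoids the ideal of the generization z of x, and gL(U) ⊆ I lies in it, so L(U) does too:
      -- every component through x has its generic point in the closure of `y`.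
      exact ((pointIdeal_isPrime z).mem_or_mem
        (resIdeal_le_pointIdeal z (hgU f hf))).resolve_left fun h =>
          hg (pointIdeal_le_iff.2 hzx h)
    have hsub : Z ⊆ closure {y} := by
      rw [← hz.def]
      exact closure_minimal (Set.singleton_subset_iff.2
        ((ProjectiveSpectrum.le_iff_mem_closure _ y z).1 hyz)) isClosed_closure
    exact Set.Subset.antisymm hsub (hZ.2 isIrreducible_singleton.closure hsub)
  exact hne ((key Z₁ h₁ hx₁).trans (key Z₂ h₂ hx₂).symm)

theorem exists_mul_ι_mem_resIdeal [IsAlgClosed k] [CharZero k] [FiniteDimensional k V]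
    (hred : AlgebraicGeometry.IsReduced (projResonance K)) {U : Submodule k (Module.Dual k V)}
    (hU : U ≠ ⊥) (hUK : IsResonanceComponent K U) {p : V} (hp : p ∈ U.dualCoannihilator) :
    ∃ g ∉ linearIdeal U, g * SymmetricAlgebra.ι k V p ∈ resIdeal K := by
  obtain ⟨x, hx⟩ := exists_pointIdeal_eq_linearIdeal (K := K) hU
    (resIdeal_le_linearIdeal hU hUK.1.1)
  have hmin := linearIdeal_mem_minimalPrimes hU hUK
  rw [← hx] at hmin
  have hpx : SymmetricAlgebra.ι k V p ∈ pointIdeal x := hx ▸ ι_mem_linearIdeal hp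
  obtain ⟨u, hu⟩ := exists_ι_notMem_pointIdeal x
  obtain ⟨y, hy, n, hyn⟩ := exists_notMem_mul_pow_mem_of_mem_minimalPrimes hmin hpx
  rw [← hx]
  have hred' : AlgebraicGeometry.IsReduced (Proj (resDeg K)) := hred
  have h1 : _root_.IsReduced
      (HomogeneousLocalization.AtPrime (resDeg K) x.asHomogeneousIdeal.toIdeal) := by
    have : _root_.IsReduced ((Proj (resDeg K)).presheaf.stalk x) :=
      isReduced_stalk_of_isReduced _ _
    exact isReduced_of_injective (Proj.stalkIso (resDeg K) x).commRingCatIsoToRingEquiv.symm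
      (RingEquiv.injective _)
  -- Reducedness of Proj concerns degree-zero fractions only, hence p/u with u a linear form not
  -- vanishing at x.
  let z : HomogeneousLocalization.AtPrime (resDeg K) x.asHomogeneousIdeal.toIdeal :=
    HomogeneousLocalization.mk ⟨1, ⟨_, mk_ι_mem_resDeg K p⟩, ⟨_, mk_ι_mem_resDeg K u⟩, hu⟩
  have hval : z.val = IsLocalization.mk' (Localization.AtPrime x.asHomogeneousIdeal.toIdeal)
      (Ideal.Quotient.mk (resIdeal K) (SymmetricAlgebra.ι k V p))
      (⟨Ideal.Quotient.mk (resIdeal K) (SymmetricAlgebra.ι k V u), hu⟩ :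
        x.asHomogeneousIdeal.toIdeal.primeCompl) := by
    rw [HomogeneousLocalization.val_mk, Localization.mk_eq_mk']
  have hz : z = 0 := by
    refine IsReduced.eq_zero z ⟨n, HomogeneousLocalization.val_injective _ ?_⟩
    rw [HomogeneousLocalization.val_pow, HomogeneousLocalization.val_zero, hval,
      ← IsLocalization.mk'_pow, IsLocalization.mk'_eq_zero_iff]
    refine ⟨⟨Ideal.Quotient.mk _ y, hy⟩, ?_⟩
    rw [← map_pow, ← map_mul, Ideal.Quotient.eq_zero_iff_mem]
    exact hyn
  rw [hz, HomogeneousLocalization.val_zero, eq_comm, IsLocalization.mk'_eq_zero_iff] at hval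
  obtain ⟨⟨g, hg⟩, hgp⟩ := hval
  obtain ⟨g, rfl⟩ := Ideal.Quotient.mk_surjective g
  refine ⟨g, hg, ?_⟩
  rwa [← map_mul, Ideal.Quotient.eq_zero_iff_mem] at hgp

theorem IsotropicResonance.separableResonance [IsAlgClosed k] [CharZero k] [FiniteDimensional k V]
    (hred : AlgebraicGeometry.IsReduced (projResonance K)) (hiso : IsotropicResonance K) :
    SeparableResonance K := by
  refine ⟨hiso.1, fun U hUK => ?_⟩
  by_cases hU : U = ⊥
  · rw [hU]
    exact isSeparableSubspace_bot K
  obtain ⟨s, hs⟩ : U.dualCoannihilator.FG := IsNoetherian.noetherian _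
  have hsU : ∀ p : s, (p : V) ∈ U.dualCoannihilator := fun p => hs ▸ Submodule.subset_span p.2
  choose g hg hgp using fun p : s => exists_mul_ι_mem_resIdeal hred hU hUK (hsU p)
  obtain ⟨x, hx⟩ := exists_ι_notMem_linearIdeal hU
  -- A point a ∈ U where this product is nonzero serves all generators of U^⊥ at once; the factor x
  -- forces a ≠ 0.
  have hG : SymmetricAlgebra.ι k V x * ∏ p, g p ∉ linearIdeal U := by
    intro h
    obtain h | h := (linearIdeal_isPrime U).mem_or_mem h
    · exact hx h
    · obtain ⟨p, -, hp⟩ := (linearIdeal_isPrime U).prod_mem_iff.1 h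
      exact hg p hp
  rw [mem_linearIdeal_iff] at hG
  push Not at hG
  obtain ⟨a, ha, hGa⟩ := hG
  rw [map_mul, SymmetricAlgebra.lift_ι_apply] at hGa
  refine isSeparableSubspace_of_isIsotropic hUK (hiso.2 U hUK) ha ?_
    fun p hp => ⟨∏ p, g p, right_ne_zero_of_mul hGa, ?_⟩
  · rintro rfl
    exact hGa (by simp)
  · rw [← hs] at hp
    induction hp using Submodule.span_induction with
    | mem p hp =>
      obtain ⟨c, hc⟩ := Finset.dvd_prod_of_mem g (Finset.mem_univ (⟨p, hp⟩ : s))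
      rw [hc, mul_right_comm]
      exact Ideal.mul_mem_right _ _ (hgp ⟨p, hp⟩)
    | zero => simp
    | add a b _ _ ha hb => rw [map_add, mul_add]; exact Ideal.add_mem _ ha hb
    | smul c a _ ha =>
      rw [map_smul, mul_smul_comm]
      exact Submodule.smul_of_tower_mem _ c ha

end KoszulResonance

end

theorem theorem1p1 {k : Type*} [Field k] [IsAlgClosed k] [CharZero k]
    {V : Type*} [AddCommGroup V] [Module k V] [FiniteDimensional k V]
    (K : Submodule k (⋀[k]^2 V)) (hlin : KoszulResonance.LinearResonance K) :
    (KoszulResonance.SeparableResonance K →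
      AlgebraicGeometry.IsReduced (KoszulResonance.projResonance K) ∧
      (irreducibleComponents (KoszulResonance.projResonance K)).PairwiseDisjoint id) ∧
    (AlgebraicGeometry.IsReduced (KoszulResonance.projResonance K) →
      KoszulResonance.IsotropicResonance K → KoszulResonance.SeparableResonance K) :=
  ⟨fun hsep => ⟨hsep.isReduced_projResonance, hsep.pairwiseDisjoint_irreducibleComponents⟩,
    fun hred hiso => hiso.separableResonance hred⟩
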